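/- Let $\mathbf k$ be a field of characteristic $0$ and let $V=\bigoplus_{p\in\mathbb Z}V_p$ be a finite-dimensional graded $\mathbf k$-space. Let $A=\mathrm{End}(V)$ be the unital graded algebra of endomorphisms of $V$, with $A_r=\{f : f(V_p)\subseteq V_{p+r}\text{ for all }p\}$ and with composition $m_2=\cdot$ as product. The Koszul sign rule is used throughout. In particular $A^{\otimes n}$ is a graded algebra with $(a_1\otimes\cdots\otimes a_n)(b_1\otimes\cdots\otimes b_n)=(-1)^{\sum_{i<j}|b_i||a_j|}a_1b_1\otimes\cdots\otimes a_nb_n$, and $[x,y]=xy-(-1)^{|x||y|}yx$. For $u\in A^{\otimes m}$ and $1\le k_1<\dots<k_m\le N$, let $u^{k_1,\dots,k_m}\in A^{\otimes N}$ be $u$ with its tensor factors placed in the positions $k_1,\dots,k_m$ and $1$ in the other positions. For $n\ge 1$ let $\mathscr F:A^{\otimes n+1}\to\mathrm{Hom}(A^{\otimes n},A)$ be the linear map with $$\mathscr F(a_1\otimes\cdots\otimes a_{n+1})(x_1,\dots,x_n)=(-1)^{\sum_{k=1}^{n}\sum_{j=k+1}^{n+1}|x_k||a_j|}\,a_1x_1a_2x_2\cdots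 a_nx_na_{n+1}$$ for homogeneous $a_j$, $x_k$. An *associative infinity-Yang–Baxter pair* in $A$ consists of two families $(\{r_n\}_{n\ge1},\{s_n\}_{n\ge1})$ with $r_n,s_n\in A^{\otimes n}$, $|r_n|=|s_n|=n-2$ and $r_1=s_1$, such that $r_1\cdot r_1=0$ and such that for all $n\ge1$ the following equation holds in $A^{\otimes n+1}$ both for $t=r$ and for $t=s$ (all of $i,j$ are $\ge1$): $$\begin{aligned}\sum_{i+j=n}(-1)^{1+i}\,t_{i+1}^{1,\dots,i+1}\,t_{j+1}^{i+1,\dots,n+1}={}&\sum_{i+j=n}\sum_{l=1}^{i}(-1)^{l-1+(j-1)(n-l-j-1)}\Big(t_{i+1}^{1,\dots,l,\,l+j+1,\dots,n+1}\,r_{j+1}^{l,\dots,l+j}+(-1)^{(1-j)i}\,s_{j+1}^{l+1,\dots,l+j+1}\,t_{i+1}^{1,\dots,l,\,l+j+1,\dots,n+1}\Big)\\&+\sum_{l=1}^{n+1}\Big((-1)^n\,t_{n+1}^{1,\dots,n+1}\,r_1^{l}+s_1^{l}\,t_{n+1}^{1,\dots,n+1}\Big).\end{aligned}$$ A *differential*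 on the graded algebra $A$ is a linear map $m_1:A\to A$ of degree $-1$ with $m_1^2=0$ and $m_1(xy)=m_1(x)y+(-1)^{|x|}x\,m_1(y)$. A *homotopy coupled Rota–Baxter operator* on the dg algebra $(A,m_1,m_2)$ consists of two families of graded maps $R_n,S_n:A^{\otimes n}\to A$, $n\ge1$, of degree $n-1$, such that for all $n\ge1$, both for $T=R$ and for $T=S$ (all of $i,j$, respectively $p,q$, are $\ge1$ in $i+j=n$, $p+q=n$), $$\begin{aligned}m_1\circ T_n+\sum_{i+j=n}(-1)^{i+1}m_2\circ(T_i\otimes T_j)={}&\sum_{p+q=n}\sum_{i=0}^{p-1}(-1)^{i+(q-1)(p-i)}\,T_p\circ\big(\mathrm{id}^{\otimes i}\otimes m_2\circ(R_q\otimes\mathrm{id})\otimes\mathrm{id}^{\otimes p-i-1}\big)\\&+\sum_{p+q=n}\sum_{i=0}^{p-1}(-1)^{i+(q-1)(p-i-1)}\,T_p\circ\big(\mathrm{id}^{\otimes i}\otimes m_2\circ(\mathrm{id}\otimes S_q)\otimes\mathrm{id}^{\otimes p-i-1}\big)\\&+(-1)^{n-1}\sum_{i=0}^{n-1}T_n\circ\big(\mathrm{id}^{\otimes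 i}\otimes m_1\otimes\mathrm{id}^{\otimes n-i-1}\big).\end{aligned}$$ Then the map $$\chi:\ \big(\{r_n\}_{n\ge1},\{s_n\}_{n\ge1}\big)\longmapsto\big(-[d_V,-],\ \{\mathscr F(r_{n+1})\}_{n\ge1},\ \{\mathscr F(s_{n+1})\}_{n\ge1}\big),\qquad d_V=r_1=s_1\in A,$$ is a bijection from the set of associative infinity-Yang–Baxter pairs in $A$ onto the set of triples $(m_1,\{R_n\}_{n\ge1},\{S_n\}_{n\ge1})$ in which $m_1$ is a differential on the graded algebra $(A,m_2)$ and $(\{R_n\},\{S_n\})$ is a homotopy coupled Rota–Baxter operator on the dg algebra $(A,m_1,m_2)$. -/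

import Mathlib

open scoped TensorProduct

noncomputable section

namespace InfYB

section GradedAlgebra

variable {k : Type*} [Field k] {A : Type*} [Ring A] [Algebra k A]

/-- The tensor power `A^{⊗ n}`. -/
abbrev TPow (k : Type*) [Field k] (A : Type*) [Ring A] [Algebra k A] (n : ℕ) : Type _ :=
  PiTensorProduct k (fun _ : Fin n => A)

/-- `n`-ary operations `A^{⊗ n} → A`, as multilinear maps. -/
abbrev Op (k : Type*) [Field k] (A : Type*) [Ring A] [Algebra k A] (n : ℕ) : Type _ :=
  MultilinearMap k (fun _ : Fin n => A) A

/-- The part of degree `d` of `A^{⊗ n}`: it is spanned by the pure tensors of homogeneous elements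
whose degrees add up to `d`. -/
def tensorDegree (𝒜 : ℤ → Submodule k A) (n : ℕ) (d : ℤ) : Submodule k (TPow k A n) :=
  Submodule.span k {t | ∃ (e : Fin n → ℤ) (a : Fin n → A),
    (∀ i, a i ∈ 𝒜 (e i)) ∧ ∑ i, e i = d ∧ t = PiTensorProduct.tprod k a}

/-- `T : A^{⊗ n} → A` is a graded map of degree `d`. -/
def IsOpOfDegree (𝒜 : ℤ → Submodule k A) {n : ℕ} (T : Op k A n) (d : ℤ) : Prop :=
  ∀ (e : Fin n → ℤ) (x : Fin n → A), (∀ i, x i ∈ 𝒜 (e i)) → T x ∈ 𝒜 (∑ i, e i + d)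

/-- The projection of a graded algebra onto the sum of its components whose degree has parity `ε`.
Koszul signs depend on the degrees only through their parities. -/
def parityProj (𝒜 : ℤ → Submodule k A) [GradedAlgebra 𝒜] (ε : ZMod 2) : A →ₗ[k] A :=
  (DirectSum.coeLinearMap 𝒜).comp
    ((DFinsupp.filterLinearMap k (fun i => 𝒜 i) (fun p : ℤ => (p : ZMod 2) = ε)).comp
      (DirectSum.decomposeLinearEquiv 𝒜).toLinearMap)

/-- The sign `(-1)^z`, as a scalar. -/
abbrev sgn (k : Type*) [Field k] (z : ℤ) : k := (-1 : k) ^ z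

/-- The product of the graded algebra `A^{⊗ n}`: for homogeneous `a i`, `b i`,
`(a₁ ⊗ ⋯ ⊗ aₙ) (b₁ ⊗ ⋯ ⊗ bₙ) = (-1)^{∑_{i < j} |b i| |a j|} a₁ b₁ ⊗ ⋯ ⊗ aₙ bₙ`. -/
def gmul (𝒜 : ℤ → Submodule k A) [GradedAlgebra 𝒜] {n : ℕ} :
    TPow k A n →ₗ[k] TPow k A n →ₗ[k] TPow k A n :=
  ∑ α : Fin n → ZMod 2, ∑ β : Fin n → ZMod 2,
    sgn k (∑ i, ∑ j, if i < j then ((β i).val : ℤ) * (α j).val else 0) •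
      PiTensorProduct.map₂ (fun i =>
        (LinearMap.mul k A).compl₁₂ (parityProj 𝒜 (α i)) (parityProj 𝒜 (β i)))

theorem extend_update {m N : ℕ} (f : Fin m → Fin N) (hf : Function.Injective f) (a : Fin m → A)
    (i : Fin m) (z : A) :
    Function.extend f (Function.update a i z) (fun _ => 1) =
      Function.update (Function.extend f a (fun _ => 1)) (f i) z := by
  funext l
  by_cases hl : ∃ p : Fin m, f p = l
  · obtain ⟨p, rfl⟩ := hl
    rw [hf.extend_apply]
    by_cases hp : p = i
    · subst hp; simp
    · rw [Function.update_of_ne hp, Function.update_of_ne (fun h' => hp (hf h')), hf.extend_apply]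
  · rw [Function.extend_apply' _ _ _ hl, Function.update_of_ne (fun h' => hl ⟨i, h'.symm⟩),
      Function.extend_apply' _ _ _ hl]

/-- For injective `f`, the map `A^{⊗ m} → A^{⊗ N}` placing the `i`-th tensor factor in position
`f i` and `1` in all the other positions. -/
def placeInj {m N : ℕ} (f : Fin m → Fin N) (hf : Function.Injective f) :
    TPow k A m →ₗ[k] TPow k A N :=
  PiTensorProduct.lift
    { toFun := fun a => PiTensorProduct.tprod k (Function.extend f a (fun _ => 1))
      map_update_add' := by
        intro inst a i x y
        obtain rfl := Subsingleton.elim inst (instDecidableEqFin m)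
        rw [extend_update f hf, extend_update f hf, extend_update f hf,
          MultilinearMap.map_update_add]
      map_update_smul' := by
        intro inst a i c x
        obtain rfl := Subsingleton.elim inst (instDecidableEqFin m)
        rw [extend_update f hf, extend_update f hf, MultilinearMap.map_update_smul] }

open Classical in
/-- The map `r ↦ r^{φ 0, …, φ (m-1)}` from `A^{⊗ m}` to `A^{⊗ N}`, with positions counted from `0`.
It is used only when `φ` maps `{0, …, m-1}` injectively into `{0, …, N-1}`, and is `0` otherwise. -/
def place {m N : ℕ} (φ : ℕ → ℕ) : TPow k A m →ₗ[k] TPow k A N :=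
  if h : ∃ f : Fin m → Fin N, Function.Injective f ∧ ∀ i, (f i : ℕ) = φ i then
    placeInj h.choose h.choose_spec.1
  else 0

theorem sandwich_aux (n : ℕ) (a : Fin (n + 1) → A) (x : Fin n → A) :
    ((LinearMap.mulRight k (a (Fin.last n))).compMultilinearMap
      ((MultilinearMap.mkPiAlgebraFin k n A).compLinearMap
        (fun i => LinearMap.mulLeft k (a i.castSucc)))) x =
    ((MultilinearMap.mkPiAlgebraFin k (n + 1) A).compLinearMap
      (fun j => LinearMap.mulRight k (Fin.snoc (α := fun _ => A) x 1 j))) a := by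
  simp only [LinearMap.compMultilinearMap_apply, MultilinearMap.compLinearMap_apply,
    MultilinearMap.mkPiAlgebraFin_apply, LinearMap.mulLeft_apply, LinearMap.mulRight_apply]
  rw [List.ofFn_succ' (fun j => a j * Fin.snoc (α := fun _ => A) x 1 j)]
  simp

/-- `a₁ ⊗ ⋯ ⊗ aₙ₊₁ ↦ ((x₁, …, xₙ) ↦ a₁ x₁ a₂ x₂ ⋯ aₙ xₙ aₙ₊₁)`, without signs. -/
def sandwich (n : ℕ) : TPow k A (n + 1) →ₗ[k] Op k A n :=
  PiTensorProduct.lift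
    { toFun := fun a => (LinearMap.mulRight k (a (Fin.last n))).compMultilinearMap
        ((MultilinearMap.mkPiAlgebraFin k n A).compLinearMap
          (fun i => LinearMap.mulLeft k (a i.castSucc)))
      map_update_add' := by
        intro inst a i y z
        ext x
        rw [add_apply, sandwich_aux, sandwich_aux, sandwich_aux,
          MultilinearMap.map_update_add]
      map_update_smul' := by
        intro inst a i c y
        ext x
        rw [smul_apply, sandwich_aux, sandwich_aux,
          MultilinearMap.map_update_smul] }

/-- The map `𝓕 : A^{⊗ (n+1)} → Hom(A^{⊗ n}, A)`: for homogeneous `a j`, `x i`,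
`𝓕 (a₁ ⊗ ⋯ ⊗ aₙ₊₁) (x₁, …, xₙ) = (-1)^{∑_{i < j} |x i| |a j|} a₁ x₁ a₂ x₂ ⋯ aₙ xₙ aₙ₊₁`. -/
def scrF (𝒜 : ℤ → Submodule k A) [GradedAlgebra 𝒜] (n : ℕ) : TPow k A (n + 1) →ₗ[k] Op k A n :=
  ∑ α : Fin (n + 1) → ZMod 2, ∑ ξ : Fin n → ZMod 2,
    sgn k (∑ i, ∑ j, if i.castSucc < j then ((ξ i).val : ℤ) * (α j).val else 0) •
      (MultilinearMap.compLinearMapₗ (fun i => parityProj 𝒜 (ξ i))).comp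
        ((sandwich n).comp (PiTensorProduct.map (fun j => parityProj 𝒜 (α j))))

/-- The graded commutator, `[x, y] = x y - (-1)^{|x| |y|} y x` for homogeneous `x`, `y`. -/
def gcomm (𝒜 : ℤ → Submodule k A) [GradedAlgebra 𝒜] : A →ₗ[k] A →ₗ[k] A :=
  ∑ ε : ZMod 2, ∑ δ : ZMod 2,
    ((LinearMap.mul k A).compl₁₂ (parityProj 𝒜 ε) (parityProj 𝒜 δ) -
      sgn k ((ε.val : ℤ) * δ.val) •
        (LinearMap.mul k A).flip.compl₁₂ (parityProj 𝒜 ε) (parityProj 𝒜 δ))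

/-- The pairs `(i, j)` with `i + j = n` and `i, j ≥ 1`. -/
def posPairs (n : ℕ) : Finset (ℕ × ℕ) :=
  (Finset.HasAntidiagonal.antidiagonal n).filter (fun p => 1 ≤ p.1 ∧ 1 ≤ p.2)

/-! ### Associative infinity-Yang-Baxter pairs

A family `{rₙ}_{n ≥ 1}` with `rₙ ∈ A^{⊗ n}` is written `r : ∀ n, TPow k A (n + 1)`: the entry `r n`
is `r_{n+1}`. -/

/-- The equation of an associative infinity-Yang-Baxter pair `(r, s)` in `A^{⊗ (n+1)}`, `n ≥ 1`, for
`t = r` and for `t = s`: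
`∑_{i+j=n} (-1)^{1+i} t_{i+1}^{1,…,i+1} t_{j+1}^{i+1,…,n+1}`
`= ∑_{i+j=n} ∑_{l=1}^{i} (-1)^{l-1+(j-1)(n-l-j-1)} (t_{i+1}^{1,…,l,l+j+1,…,n+1} r_{j+1}^{l,…,l+j}`
`    + (-1)^{(1-j)i} s_{j+1}^{l+1,…,l+j+1} t_{i+1}^{1,…,l,l+j+1,…,n+1})`
`  + ∑_{l=1}^{n+1} ((-1)^n t_{n+1} r_1^l + s_1^l t_{n+1})`,
with `i, j ≥ 1` throughout. The last line collects the terms with `j = 0` or `i = 0`. -/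
def YBEquation (𝒜 : ℤ → Submodule k A) [GradedAlgebra 𝒜] (r s t : ∀ n : ℕ, TPow k A (n + 1))
    (n : ℕ) : Prop :=
  ∑ p ∈ posPairs n,
    sgn k (1 + p.1) •
      gmul 𝒜 (place (N := n + 1) (fun a => a) (t p.1)) (place (fun a => p.1 + a) (t p.2)) =
  ∑ p ∈ posPairs n, ∑ l ∈ Finset.Icc 1 p.1,
    sgn k (l - 1 + (p.2 - 1) * (n - l - p.2 - 1)) •
      (gmul 𝒜 (place (N := n + 1) (fun a => if a < l then a else a + p.2) (t p.1))
          (place (fun a => l - 1 + a) (r p.2)) +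
        sgn k ((1 - p.2) * p.1) •
          gmul 𝒜 (place (N := n + 1) (fun a => l + a) (s p.2))
            (place (fun a => if a < l then a else a + p.2) (t p.1))) +
  ∑ l ∈ Finset.range (n + 1),
    (sgn k n • gmul 𝒜 (t n) (place (fun a => l + a) (r 0)) +
      gmul 𝒜 (place (fun a => l + a) (s 0)) (t n))

/-- Associative infinity-Yang-Baxter pairs in the unital graded algebra `A`. -/
structure IsInfYBPair (𝒜 : ℤ → Submodule k A) [GradedAlgebra 𝒜]
    (r s : ∀ n : ℕ, TPow k A (n + 1)) : Prop where
  r_degree : ∀ n : ℕ, r n ∈ tensorDegree 𝒜 (n + 1) ((n : ℤ) - 1)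
  s_degree : ∀ n : ℕ, s n ∈ tensorDegree 𝒜 (n + 1) ((n : ℤ) - 1)
  one_eq : r 0 = s 0
  sq_zero : gmul 𝒜 (r 0) (r 0) = 0
  eq_r : ∀ n : ℕ, 1 ≤ n → YBEquation 𝒜 r s r n
  eq_s : ∀ n : ℕ, 1 ≤ n → YBEquation 𝒜 r s s n

/-! ### Homotopy coupled Rota-Baxter operators on dg algebras

A family `{Rₙ}_{n ≥ 1}` of operations is written `R : ∀ n, Op k A (n + 1)`: the entry `R n` is
`R_{n+1}`. Equations between operations are tested on homogeneous elements `x 0, …, x (n-1)`, which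
are read off from a sequence `x : ℕ → A`. -/

/-- `m` is a differential on the graded algebra `A`: a derivation of degree `-1` and square zero. -/
structure IsDifferential (𝒜 : ℤ → Submodule k A) (m : A →ₗ[k] A) : Prop where
  degree : ∀ (d : ℤ) (x : A), x ∈ 𝒜 d → m x ∈ 𝒜 (d - 1)
  sq_zero : ∀ x : A, m (m x) = 0
  leibniz : ∀ (d : ℤ) (x y : A), x ∈ 𝒜 d → m (x * y) = m x * y + sgn k d • (x * m y)

/-- `R_n (x 0, …, x (n-1))`, for `n ≥ 1`. -/
def ev (R : ∀ n : ℕ, Op k A (n + 1)) (n : ℕ) (x : ℕ → A) : A :=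
  R (n - 1) (fun a => x a)

/-- The sequence `x 0, …, x (i-1), y, x (i+q+1), x (i+q+2), …`, where `y` replaces the `q + 1`
entries `x i, …, x (i+q)`. -/
def splice (x : ℕ → A) (i q : ℕ) (y : A) : ℕ → A :=
  fun a => if a < i then x a else if a = i then y else x (a + q)

/-- The equation of a homotopy coupled Rota-Baxter operator `(R, S)` on the dg algebra `(A, m, ·)`
in arity `n ≥ 1`, for `T = R` and for `T = S`; with `μ` the product of `A` it reads
`m ∘ T_n + ∑_{i+j=n} (-1)^{i+1} μ ∘ (T_i ⊗ T_j)`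
`= ∑_{p+q=n} ∑_{i=0}^{p-1} (-1)^{i+(q-1)(p-i)} T_p ∘ (id^i ⊗ μ ∘ (R_q ⊗ id) ⊗ id^{p-i-1})`
`+ ∑_{p+q=n} ∑_{i=0}^{p-1} (-1)^{i+(q-1)(p-i-1)} T_p ∘ (id^i ⊗ μ ∘ (id ⊗ S_q) ⊗ id^{p-i-1})`
`+ (-1)^{n-1} ∑_{i=0}^{n-1} T_n ∘ (id^i ⊗ m ⊗ id^{n-i-1})`,
with `i, j, p, q ≥ 1` in `i + j = n` and `p + q = n`. The second sign in each term is the Koszul sign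
of moving an operation past the arguments to its left; `|T_j| = j - 1` and `|m| = -1`. -/
def RBEquation (𝒜 : ℤ → Submodule k A) (m : A →ₗ[k] A) (R S T : ∀ n : ℕ, Op k A (n + 1))
    (n : ℕ) : Prop :=
  ∀ (e : ℕ → ℤ) (x : ℕ → A), (∀ a, x a ∈ 𝒜 (e a)) →
    m (ev T n x) +
      ∑ p ∈ posPairs n,
        (sgn k (p.1 + 1) * sgn k ((p.2 - 1) * ∑ a ∈ Finset.range p.1, e a)) •
          (ev T p.1 x * ev T p.2 (fun a => x (p.1 + a))) =
    ∑ p ∈ posPairs n, ∑ i ∈ Finset.range p.1,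
      (sgn k (i + (p.2 - 1) * (p.1 - i)) * sgn k ((p.2 - 1) * ∑ a ∈ Finset.range i, e a)) •
        ev T p.1 (splice x i p.2 (ev R p.2 (fun a => x (i + a)) * x (i + p.2))) +
    ∑ p ∈ posPairs n, ∑ i ∈ Finset.range p.1,
      (sgn k (i + (p.2 - 1) * (p.1 - i - 1)) *
          sgn k ((p.2 - 1) * ∑ a ∈ Finset.range (i + 1), e a)) •
        ev T p.1 (splice x i p.2 (x i * ev S p.2 (fun a => x (i + 1 + a)))) +
    sgn k (n - 1) • ∑ i ∈ Finset.range n,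
      sgn k (∑ a ∈ Finset.range i, e a) • ev T n (splice x i 0 (m (x i)))

/-- `(R, S)` is a homotopy coupled Rota-Baxter operator on the dg algebra `(A, m, ·)`. -/
structure IsHomotopyCoupledRB (𝒜 : ℤ → Submodule k A) (m : A →ₗ[k] A)
    (R S : ∀ n : ℕ, Op k A (n + 1)) : Prop where
  R_degree : ∀ n : ℕ, IsOpOfDegree 𝒜 (R n) n
  S_degree : ∀ n : ℕ, IsOpOfDegree 𝒜 (S n) n
  eq_R : ∀ n : ℕ, 1 ≤ n → RBEquation 𝒜 m R S R n
  eq_S : ∀ n : ℕ, 1 ≤ n → RBEquation 𝒜 m R S S n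

/-- The map `({rₙ}, {sₙ}) ↦ (-[d, -], {𝓕 (r_{n+1})}_{n ≥ 1}, {𝓕 (s_{n+1})}_{n ≥ 1})`, where
`d = r₁ ∈ A^{⊗ 1} = A`. -/
def chi (𝒜 : ℤ → Submodule k A) [GradedAlgebra 𝒜]
    (rs : (∀ n : ℕ, TPow k A (n + 1)) × (∀ n : ℕ, TPow k A (n + 1))) :
    (A →ₗ[k] A) × (∀ n : ℕ, Op k A (n + 1)) × (∀ n : ℕ, Op k A (n + 1)) :=
  (-gcomm 𝒜 (PiTensorProduct.subsingletonEquiv (0 : Fin 1) (rs.1 0)),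
    fun n => scrF 𝒜 (n + 1) (rs.1 (n + 1)),
    fun n => scrF 𝒜 (n + 1) (rs.2 (n + 1)))

end GradedAlgebra

section Endomorphisms

variable {k : Type*} [Field k] {V : Type*} [AddCommGroup V] [Module k V]

/-- The component of degree `r` of `End(V)`: the endomorphisms mapping each `V_p` to `V_{p+r}`. -/
def endGrading (𝒱 : ℤ → Submodule k V) (r : ℤ) : Submodule k (Module.End k V) where
  carrier := {f | ∀ p : ℤ, ∀ v ∈ 𝒱 p, f v ∈ 𝒱 (p + r)}
  add_mem' hf hg p v hv := (𝒱 _).add_mem (hf p v hv) (hg p v hv)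
  zero_mem' _ _ _ := (𝒱 _).zero_mem
  smul_mem' c _ hf p v hv := (𝒱 _).smul_mem c (hf p v hv)

theorem endGrading_isInternal [FiniteDimensional k V] (𝒱 : ℤ → Submodule k V)
    [DirectSum.Decomposition 𝒱] : DirectSum.IsInternal (endGrading 𝒱) := by
  classical
  have hV := DirectSum.Decomposition.isInternal 𝒱
  have hsupp : {p | 𝒱 p ≠ ⊥}.Finite :=
    WellFoundedGT.finite_ne_bot_of_iSupIndep hV.submodule_iSupIndep
  let P : ℤ → V →ₗ[k] V := fun p =>
    (𝒱 p).subtype ∘ₗ DirectSum.component k ℤ (fun i => 𝒱 i) p ∘ₗ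
      (DirectSum.decomposeLinearEquiv 𝒱).toLinearMap
  have hP : ∀ p v, P p v = (DirectSum.decompose 𝒱 v p : V) := fun p v => rfl
  have hPm : ∀ p v, P p v ∈ 𝒱 p := fun p v => by rw [hP]; exact Subtype.property _
  have hPs : ∀ p v, v ∈ 𝒱 p → P p v = v := fun p v hv => by
    rw [hP]; exact DirectSum.decompose_of_mem_same 𝒱 hv
  have hPn : ∀ p q v, v ∈ 𝒱 p → p ≠ q → P q v = 0 := fun p q v hv h => by
    rw [hP]; exact DirectSum.decompose_of_mem_ne 𝒱 hv h
  have hsum : ∀ v, ∑ p ∈ hsupp.toFinset, P p v = v := by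
    intro v
    conv_rhs => rw [← DirectSum.sum_support_decompose 𝒱 v]
    symm
    apply Finset.sum_subset
    · intro p hp
      simp only [Set.Finite.mem_toFinset, Set.mem_ofPred_eq]
      intro h0
      rw [DFinsupp.mem_support_iff] at hp
      apply hp
      have := (DirectSum.decompose 𝒱 v p).property
      exact Subtype.ext (by simpa using h0.le this)
    · intro p _ hp
      rw [DFinsupp.notMem_support_iff] at hp
      simp [hp]
  constructor
  · intro x y hxy
    rw [← sub_eq_zero] at hxy ⊢
    rw [← map_sub] at hxy
    generalize x - y = z at hxy ⊢
    ext1 r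
    apply Subtype.ext
    rw [DirectSum.zero_apply, ZeroMemClass.coe_zero]
    have key : ∀ p, ∀ v ∈ 𝒱 p, (z r : Module.End k V) v = 0 := by
      intro p v hv
      have h1 : (DirectSum.coeAddMonoidHom (endGrading 𝒱) z : Module.End k V) v = 0 := by
        rw [hxy]; rfl
      rw [DirectSum.coeAddMonoidHom_eq_dfinsuppSum, DFinsupp.sum, LinearMap.sum_apply] at h1
      have h2 := congrArg (P (p + r)) h1
      rw [map_sum, map_zero, Finset.sum_eq_single r] at h2
      · rwa [hPs _ _ ((z r).property p v hv)] at h2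
      · intro b _ hb
        exact hPn (p + b) _ _ ((z b).property p v hv) (by simpa using hb)
      · intro hr
        rw [DFinsupp.notMem_support_iff] at hr
        simp [hr]
    ext v
    rw [← hsum v, map_sum]
    exact Finset.sum_eq_zero (fun p _ => key p _ (hPm p v))
  · intro f
    have hmem : ∀ p q, P q ∘ₗ f ∘ₗ P p ∈ endGrading 𝒱 (q - p) := by
      intro p q p' v hv
      by_cases h : p' = p
      · subst h
        have : p' + (q - p') = q := by ring
        rw [this]; exact hPm q _
      · simp [hPn p' p v hv h]
    refine ⟨∑ p ∈ hsupp.toFinset, ∑ q ∈ hsupp.toFinset,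
      DirectSum.of (fun i => endGrading 𝒱 i) (q - p) ⟨_, hmem p q⟩, ?_⟩
    simp only [map_sum, DirectSum.coeAddMonoidHom_of]
    ext v
    simp only [LinearMap.sum_apply, LinearMap.comp_apply]
    rw [Finset.sum_congr rfl (fun p _ => hsum (f (P p v))), ← map_sum, hsum]

/-- `End(V)`, with composition as product, is a graded algebra. -/
instance endGradedAlgebra [FiniteDimensional k V] (𝒱 : ℤ → Submodule k V)
    [DirectSum.Decomposition 𝒱] : GradedAlgebra (endGrading 𝒱) where
  one_mem p v hv := by simpa using hv
  mul_mem i j f g hf hg p v hv := by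
    have := hf _ _ (hg p v hv)
    rwa [add_assoc, add_comm j i] at this
  toDecomposition := (endGrading_isInternal 𝒱).chooseDecomposition

end Endomorphisms

end InfYB

end

/-!
The map `𝓕` turns the Yang-Baxter equations into the Rota-Baxter equations, and for `A = End(V)`
it is a bijection that preserves degrees.

*The equations.* On homogeneous pure tensors, `𝓕 (a₀ ⊗ ⋯ ⊗ aₙ) (x₀, …, xₙ₋₁)` is the word
`a₀ x₀ a₁ ⋯ xₙ₋₁ aₙ` up to sign, and the sign can be written letter by letter: `a j` is multiplied by the
sign of moving it past `x₀, …, xⱼ₋₁` (`scrF_pureTensor`). The same holds for the product of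
`A^{⊗ n}` (`gmul_pureTensor`). Cutting words at a letter then gives three composition formulas. Under
`𝓕`, the product `t^{0,…,p} u^{p,…,p+q}` becomes the product of the operations of `t` and `u`
(`scrF_concat`), and the products of a tensor `t` with a gap and a tensor filling this gap become
the insertion of `R (x, …) x` or of `x S (x, …)` into the operation of `t` (`scrF_compLeft`,
`scrF_compRight`). Each formula carries the sign prescribed by the Koszul rule. The terms of the
Yang-Baxter equation containing `d = r₁ = s₁` are the cases in which one of the tensors is `d`,
and they add up to the terms containing `m₁ = -[d, -]` (`scrF_differential_terms`). Hence the two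
equations are equivalent as soon as `𝓕` is injective (`YBEquation_iff_RBEquation`).

*The bijection.* In a homogeneous basis of `V`, the map `𝓕` sends tensors of matrix units
`e u₀ v₀ ⊗ ⋯ ⊗ e uₙ vₙ`, up to sign, to the operations that send the tuple of the `e vᵢ uᵢ₊₁` to `e u₀ vₙ`
and all other tuples of matrix units to `0`. This yields an explicit inverse (`scrG`), which
preserves degrees.

*The differential.* Every derivation of degree `-1` of `End(V)` is inner (`exists_eq_gcomm`). An
element of nonzero degree that commutes with all endomorphisms of degree `0` vanishes
(`eq_zero_of_commute`); so `d` is determined by `-[d, -]`, and `m₁² = 0` is equivalent to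
`d² = 0`.
-/

noncomputable section

namespace InfYB

/-! ### Signs and homogeneous pure tensors -/

section Signs

variable {k : Type*} [Field k]

theorem sgn_congr {a b : ℤ} (h : (a : ZMod 2) = b) : sgn k a = sgn k b := by
  obtain ⟨c, hc⟩ := (ZMod.intCast_eq_intCast_iff_dvd_sub a b 2).1 h
  obtain rfl : b = a + 2 * c := by push_cast at hc; linarith
  rw [sgn, sgn, zpow_add₀ (by norm_num), zpow_mul]
  norm_num

theorem sgn_eq_of_eq_add {a b : ℤ} (c : ℤ) (h : a = b + 2 * c) : sgn k a = sgn k b := by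
  apply sgn_congr
  rw [h]
  push_cast
  rw [show (2 : ZMod 2) = 0 from rfl, zero_mul, add_zero]

theorem sgn_add (a b : ℤ) : sgn k (a + b) = sgn k a * sgn k b :=
  zpow_add₀ (by norm_num) a b

theorem sgn_zero : sgn k 0 = 1 := zpow_zero _

theorem sgn_mul_self (a : ℤ) : sgn k a * sgn k a = 1 := by
  rw [← sgn_add, sgn_eq_of_eq_add a (by ring : a + a = 0 + 2 * a), sgn_zero]

theorem sgn_sum {ι : Type*} (s : Finset ι) (f : ι → ℤ) :
    sgn k (∑ i ∈ s, f i) = ∏ i ∈ s, sgn k (f i) := by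
  classical
  induction s using Finset.induction_on with
  | empty => simp
  | insert a s ha ih => rw [Finset.sum_insert ha, Finset.prod_insert ha, sgn_add, ih]

end Signs

section Homogeneous

variable {k : Type*} [Field k] {A : Type*} [Ring A] [Algebra k A]

/-- The sign exponent `∑_{i < j} |b i| |a j|` of the product of `a₀ ⊗ ⋯ ⊗ aₙ₋₁` and
`b₀ ⊗ ⋯ ⊗ bₙ₋₁`. -/
def mulExp {n : ℕ} (α β : Fin n → ℤ) : ℤ := ∑ i, ∑ j, if i < j then β i * α j else 0

/-- The sign exponent `∑_{i < j} |x i| |a j|` in the value of `𝓕 (a₀ ⊗ ⋯ ⊗ aₙ)` at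
`(x₀, …, xₙ₋₁)`. -/
def evalExp {n : ℕ} (α : Fin (n + 1) → ℤ) (ξ : Fin n → ℤ) : ℤ :=
  ∑ i, ∑ j, if i.castSucc < j then ξ i * α j else 0

variable {𝒜 : ℤ → Submodule k A} [GradedAlgebra 𝒜]

theorem parityProj_of_mem {d : ℤ} {a : A} (ha : a ∈ 𝒜 d) (ε : ZMod 2) :
    parityProj 𝒜 ε a = if ε = (d : ZMod 2) then a else 0 := by
  simp only [parityProj, LinearMap.comp_apply, LinearEquiv.coe_coe,
    DirectSum.decomposeLinearEquiv_apply, DirectSum.decompose_of_mem 𝒜 ha]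
  rw [DFinsupp.filterLinearMap_apply]
  erw [DFinsupp.filter_single]
  by_cases h : ε = (d : ZMod 2)
  · rw [if_pos h, if_pos h.symm]
    exact DirectSum.coeLinearMap_of 𝒜 d ⟨a, ha⟩
  · rw [if_neg h, if_neg (fun h' => h h'.symm), map_zero]

/-- On homogeneous entries, a sum over all parities reduces to the term of the actual parities. -/
theorem sum_parity {n : ℕ} {M : Type*} [AddCommGroup M] [Module k M]
    {α : Fin n → ℤ} {a : Fin n → A} (ha : ∀ i, a i ∈ 𝒜 (α i))
    (F : (Fin n → ZMod 2) → MultilinearMap k (fun _ : Fin n => A) M) :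
    ∑ ε : Fin n → ZMod 2, F ε (fun i => parityProj 𝒜 (ε i) (a i)) =
      F (fun i => (α i : ZMod 2)) a := by
  rw [Finset.sum_eq_single (fun i => (α i : ZMod 2))]
  · congr 1
    funext i
    rw [parityProj_of_mem (ha i), if_pos rfl]
  · intro ε _ hε
    obtain ⟨i, hi⟩ := Function.ne_iff.1 hε
    exact MultilinearMap.map_coord_zero _ i (by rw [parityProj_of_mem (ha i), if_neg hi])
  · simp

theorem gmul_tprod {n : ℕ} {α β : Fin n → ℤ} {a b : Fin n → A} (ha : ∀ i, a i ∈ 𝒜 (α i))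
    (hb : ∀ i, b i ∈ 𝒜 (β i)) :
    gmul 𝒜 (PiTensorProduct.tprod k a) (PiTensorProduct.tprod k b) =
      sgn k (mulExp α β) • PiTensorProduct.tprod k (fun i => a i * b i) := by
  simp only [gmul, LinearMap.sum_apply, LinearMap.smul_apply, PiTensorProduct.map₂_tprod_tprod,
    LinearMap.compl₁₂_apply, LinearMap.mul_apply']
  have key : ∀ ε : Fin n → ZMod 2, ∀ δ : Fin n → ZMod 2,
      PiTensorProduct.tprod k (fun i => parityProj 𝒜 (ε i) (a i) * parityProj 𝒜 (δ i) (b i)) =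
      ((PiTensorProduct.tprod k).compLinearMap
        (fun i => LinearMap.mulLeft k (parityProj 𝒜 (ε i) (a i))))
        (fun i => parityProj 𝒜 (δ i) (b i)) := fun ε δ => by simp
  have key2 : ∀ ε : Fin n → ZMod 2,
      PiTensorProduct.tprod k (fun i => parityProj 𝒜 (ε i) (a i) * b i) =
      ((PiTensorProduct.tprod k).compLinearMap
        (fun i => LinearMap.mulRight k (b i)))
        (fun i => parityProj 𝒜 (ε i) (a i)) := fun ε => by simp
  have step : ∀ ε : Fin n → ZMod 2, ∑ δ : Fin n → ZMod 2,
      sgn k (∑ i, ∑ j, if i < j then ((δ i).val : ℤ) * (ε j).val else 0) •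
        PiTensorProduct.tprod k
          (fun i => parityProj 𝒜 (ε i) (a i) * parityProj 𝒜 (δ i) (b i)) =
      sgn k (∑ i, ∑ j, if i < j then (((β i : ZMod 2)).val : ℤ) * (ε j).val else 0) •
        PiTensorProduct.tprod k (fun i => parityProj 𝒜 (ε i) (a i) * b i) := by
    intro ε
    simp only [key ε]
    simpa using sum_parity hb (fun δ =>
      sgn k (∑ i, ∑ j, if i < j then ((δ i).val : ℤ) * (ε j).val else 0) •
        ((PiTensorProduct.tprod k).compLinearMap
          (fun i => LinearMap.mulLeft k (parityProj 𝒜 (ε i) (a i)))))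
  simp only [step, key2]
  have := sum_parity ha (fun ε =>
      sgn k (∑ i, ∑ j, if i < j then (((β i : ZMod 2)).val : ℤ) * (ε j).val else 0) •
        ((PiTensorProduct.tprod k).compLinearMap (fun i => LinearMap.mulRight k (b i))))
  simp only [smul_apply] at this
  rw [this]
  simp only [MultilinearMap.compLinearMap_apply, LinearMap.mulRight_apply]
  congr 1
  apply sgn_congr
  simp [mulExp]

theorem sandwich_tprod (n : ℕ) (a : Fin (n + 1) → A) (x : Fin n → A) :
    sandwich (k := k) n (PiTensorProduct.tprod k a) x =
      (List.ofFn (fun i => a i.castSucc * x i)).prod * a (Fin.last n) := by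
  simp [sandwich, PiTensorProduct.lift.tprod]

theorem scrF_tprod {n : ℕ} {α : Fin (n + 1) → ℤ} {ξ : Fin n → ℤ} {a : Fin (n + 1) → A}
    {x : Fin n → A} (ha : ∀ i, a i ∈ 𝒜 (α i)) (hx : ∀ i, x i ∈ 𝒜 (ξ i)) :
    scrF 𝒜 n (PiTensorProduct.tprod k a) x =
      sgn k (evalExp α ξ) • sandwich n (PiTensorProduct.tprod k a) x := by
  simp only [scrF, LinearMap.sum_apply, LinearMap.smul_apply, LinearMap.comp_apply,
    PiTensorProduct.map_tprod, sum_apply, smul_apply,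
    MultilinearMap.compLinearMapₗ_apply, MultilinearMap.compLinearMap_apply]
  have step : ∀ ε : Fin (n + 1) → ZMod 2, ∑ δ : Fin n → ZMod 2,
      sgn k (∑ i, ∑ j, if i.castSucc < j then ((δ i).val : ℤ) * (ε j).val else 0) •
        sandwich n (PiTensorProduct.tprod k (fun j => parityProj 𝒜 (ε j) (a j)))
          (fun i => parityProj 𝒜 (δ i) (x i)) =
      sgn k (∑ i, ∑ j, if i.castSucc < j then (((ξ i : ZMod 2)).val : ℤ) * (ε j).val else 0) •
        sandwich n (PiTensorProduct.tprod k (fun j => parityProj 𝒜 (ε j) (a j))) x := by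
    intro ε
    simpa using sum_parity hx (fun δ =>
      sgn k (∑ i, ∑ j, if i.castSucc < j then ((δ i).val : ℤ) * (ε j).val else 0) •
        sandwich n (PiTensorProduct.tprod k (fun j => parityProj 𝒜 (ε j) (a j))))
  simp only [step]
  have := congrArg (fun T : Op k A n => T x) (sum_parity ha (fun ε =>
      sgn k (∑ i, ∑ j, if i.castSucc < j then (((ξ i : ZMod 2)).val : ℤ) * (ε j).val else 0) •
        (sandwich (k := k) (A := A) n).compMultilinearMap (PiTensorProduct.tprod k)))
  simp only [sum_apply, smul_apply, LinearMap.compMultilinearMap_apply] at this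
  rw [this]
  congr 1
  apply sgn_congr
  simp [evalExp]

theorem gcomm_apply {d e : ℤ} {x y : A} (hx : x ∈ 𝒜 d) (hy : y ∈ 𝒜 e) :
    gcomm 𝒜 x y = x * y - sgn k (d * e) • (y * x) := by
  simp only [gcomm, LinearMap.sum_apply, LinearMap.sub_apply, LinearMap.smul_apply,
    LinearMap.compl₁₂_apply, LinearMap.mul_apply', LinearMap.flip_apply, parityProj_of_mem hx,
    parityProj_of_mem hy]
  rw [Finset.sum_eq_single (d : ZMod 2), Finset.sum_eq_single (e : ZMod 2)]
  · simp only [if_true]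
    congr 2
    apply sgn_congr
    simp
  · intro b _ hb
    simp [hb]
  · simp
  · intro b _ hb
    simp [hb]
  · simp

end Homogeneous

/-! ### Words -/

section Words

variable {k : Type*} [Field k] {A : Type*} [Ring A] [Algebra k A]

/-- The word `a₀ x₀ a₁ x₁ ⋯ xₙ₋₁ aₙ`. -/
def word (a x : ℕ → A) : ℕ → A
  | 0 => a 0
  | n + 1 => word a x n * (x n * a (n + 1))

theorem word_congr {a a' x x' : ℕ → A} {n : ℕ} (ha : ∀ j ≤ n, a j = a' j)
    (hx : ∀ j < n, x j = x' j) : word a x n = word a' x' n := by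
  induction n with
  | zero => exact ha 0 le_rfl
  | succ n ih =>
    rw [word, word, ih (fun j hj => ha j (by omega)) (fun j hj => hx j (by omega)),
      ha (n + 1) le_rfl, hx n (by omega)]

/-- Signs that depend multiplicatively on the degrees of the letters collect into one sign, which
depends on the total degree. -/
theorem word_smul (z : ℤ) (β : ℕ → ℤ) {a b : ℕ → A} (x : ℕ → A) {n : ℕ}
    (h : ∀ j ≤ n, a j = sgn k (z * β j) • b j) :
    word a x n = sgn k (z * ∑ j ∈ Finset.range (n + 1), β j) • word b x n := by
  induction n with
  | zero => simpa [word] using h 0 le_rfl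
  | succ n ih =>
    rw [word, word, ih (fun j hj => h j (by omega)), h (n + 1) le_rfl,
      Finset.sum_range_succ _ (n + 1), mul_add z, sgn_add]
    simp only [smul_mul_assoc, mul_smul_comm, smul_smul]
    rw [mul_comm (sgn k (z * β (n + 1)))]

/-- Multiplying two words amounts to multiplying the last letter of the first by the first letter
of the second. -/
theorem word_mul_word {a b c x : ℕ → A} {p q : ℕ} (ha : ∀ j < p, c j = a j)
    (hab : c p = a p * b 0) (hb : ∀ j, 1 ≤ j → j ≤ q → c (p + j) = b j) :
    word c x (p + q) = word a x p * word b (fun j => x (p + j)) q := by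
  induction q with
  | zero =>
    cases p with
    | zero => exact hab
    | succ p =>
      rw [add_zero, word, word, word, hab, word_congr (fun j hj => ha j (by omega))
        (fun _ _ => rfl)]
      simp only [mul_assoc]
  | succ q ih =>
    rw [← add_assoc, word, word, ih (fun j h1 h2 => hb j h1 (by omega)), add_assoc p q 1,
      hb (q + 1) (by omega) le_rfl, mul_assoc]

/-- Cutting a word at the letter `x l`. -/
theorem word_cut (a x : ℕ → A) (l m : ℕ) :
    word a x (l + 1 + m) =
      word a x l * x l * word (fun j => a (l + 1 + j)) (fun j => x (l + 1 + j)) m := by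
  induction m with
  | zero => rw [add_zero, word, word, mul_assoc]
  | succ m ih => rw [← add_assoc, word, word, ih]; simp only [mul_assoc, add_assoc]

theorem sandwich_eq_word (n : ℕ) (a x : ℕ → A) :
    sandwich (k := k) n (PiTensorProduct.tprod k (fun i : Fin (n + 1) => a i))
      (fun i : Fin n => x i) = word a x n := by
  rw [sandwich_tprod]
  induction n with
  | zero => simp [word]
  | succ n ih =>
    rw [word, ← ih, List.ofFn_succ', List.concat_eq_append, List.prod_append]
    simp [mul_assoc]

theorem word_mem {𝒜 : ℤ → Submodule k A} [GradedAlgebra 𝒜] {α e : ℕ → ℤ} {a x : ℕ → A} {n : ℕ}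
    (ha : ∀ j, a j ∈ 𝒜 (α j)) (hx : ∀ j, x j ∈ 𝒜 (e j)) :
    word a x n ∈ 𝒜 (∑ j ∈ Finset.range (n + 1), α j + ∑ j ∈ Finset.range n, e j) := by
  induction n with
  | zero => simpa [word] using ha 0
  | succ n ih =>
    rw [word, Finset.sum_range_succ _ (n + 1), Finset.sum_range_succ e]
    convert SetLike.mul_mem_graded ih (SetLike.mul_mem_graded (hx n) (ha (n + 1))) using 2
    ring

end Words

/-! ### Pure tensors given by sequences -/

section Sequences

variable {k : Type*} [Field k] {A : Type*} [Ring A] [Algebra k A]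

/-- The pure tensor `a₀ ⊗ ⋯ ⊗ aₙ₋₁`, read off from a sequence. -/
def pureTensor (k : Type*) [Field k] {A : Type*} [Ring A] [Algebra k A] (n : ℕ) (a : ℕ → A) :
    TPow k A n :=
  PiTensorProduct.tprod k (fun i : Fin n => a i)

/-- The sequence `a` with the sign of moving `a j` to the left past `e 0, …, e (j - 1)`, where `α`
and `e` are sequences of degrees. -/
def koszul (k : Type*) [Field k] {A : Type*} [Ring A] [Algebra k A] (α e : ℕ → ℤ) (a : ℕ → A) :
    ℕ → A :=
  fun j => sgn k ((∑ i ∈ Finset.range j, e i) * α j) • a j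

theorem pureTensor_koszul (n : ℕ) (α e : ℕ → ℤ) (a : ℕ → A) :
    pureTensor k n (koszul k α e a) =
      sgn k (∑ j ∈ Finset.range n, (∑ i ∈ Finset.range j, e i) * α j) • pureTensor k n a := by
  rw [sgn_sum, Finset.prod_range (fun j => sgn k ((∑ i ∈ Finset.range j, e i) * α j))]
  exact MultilinearMap.map_smul_univ _ _ _

theorem sum_fin_lt (n : ℕ) (f : ℕ → ℤ) {j : ℕ} (hj : j ≤ n) :
    ∑ i : Fin n, (if (i : ℕ) < j then f i else 0) = ∑ i ∈ Finset.range j, f i := by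
  rw [← Finset.sum_range (fun i => if i < j then f i else 0), ← Finset.sum_filter]
  congr 1
  ext i
  simp only [Finset.mem_filter, Finset.mem_range]
  omega

variable {𝒜 : ℤ → Submodule k A} [GradedAlgebra 𝒜]

/-- In a product of pure tensors the sign can be distributed over the factors: `a j` takes the sign
of passing `b 0, …, b (j - 1)`. -/
theorem gmul_pureTensor {α β : ℕ → ℤ} {a b : ℕ → A} (ha : ∀ j, a j ∈ 𝒜 (α j))
    (hb : ∀ j, b j ∈ 𝒜 (β j)) (n : ℕ) :
    gmul 𝒜 (pureTensor k n a) (pureTensor k n b) =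
      pureTensor k n (fun j => koszul k α β a j * b j) := by
  have h1 : pureTensor k n (fun j => koszul k α β a j * b j) =
      pureTensor k n (koszul k α β (fun j => a j * b j)) := by
    congr 1
    funext j
    simp only [koszul, smul_mul_assoc]
  rw [h1, pureTensor_koszul]
  unfold pureTensor
  rw [gmul_tprod (fun i : Fin n => ha i) (fun i : Fin n => hb i)]
  congr 2
  rw [mulExp, Finset.sum_comm,
    Finset.sum_range (fun j => (∑ i ∈ Finset.range j, β i) * α j)]
  refine Finset.sum_congr rfl (fun j _ => ?_)
  rw [← sum_fin_lt n β j.2.le, Finset.sum_mul]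
  refine Finset.sum_congr rfl (fun i _ => ?_)
  simp only [Fin.lt_def]
  split_ifs <;> simp

/-- In `𝓕 (a₀ ⊗ ⋯ ⊗ aₙ) (x₀, …, xₙ₋₁)` the sign can be distributed over the letters of the word:
`a j` takes the sign of passing `x 0, …, x (j - 1)`. -/
theorem scrF_pureTensor {α e : ℕ → ℤ} {a x : ℕ → A} (ha : ∀ j, a j ∈ 𝒜 (α j))
    (hx : ∀ j, x j ∈ 𝒜 (e j)) (n : ℕ) :
    scrF 𝒜 n (pureTensor k (n + 1) a) (fun i => x i) = word (koszul k α e a) x n := by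
  rw [← sandwich_eq_word (k := k)]
  change _ = sandwich (k := k) n (pureTensor k (n + 1) (koszul k α e a)) _
  rw [pureTensor_koszul, map_smul, smul_apply]
  unfold pureTensor
  rw [scrF_tprod (fun i : Fin (n + 1) => ha i) (fun i : Fin n => hx i)]
  congr 2
  rw [evalExp, Finset.sum_comm,
    Finset.sum_range (fun j => (∑ i ∈ Finset.range j, e i) * α j)]
  refine Finset.sum_congr rfl (fun j _ => ?_)
  rw [← sum_fin_lt n e (Nat.lt_succ_iff.1 j.2), Finset.sum_mul]
  refine Finset.sum_congr rfl (fun i _ => ?_)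
  simp only [Fin.lt_def, Fin.val_castSucc]
  split_ifs <;> simp

/-- A homogeneous tensor is a combination of pure tensors of homogeneous sequences, which may be
taken to continue with `1` in degree `0`. -/
theorem tensorDegree_induction {n : ℕ} {d : ℤ} {P : TPow k A n → Prop} (zero : P 0)
    (add : ∀ t u, P t → P u → P (t + u)) (smul : ∀ (c : k) t, P t → P (c • t))
    (pure : ∀ (α : ℕ → ℤ) (a : ℕ → A), (∀ j, a j ∈ 𝒜 (α j)) → (∀ j, n ≤ j → a j = 1) →
      (∀ j, n ≤ j → α j = 0) → ∑ j ∈ Finset.range n, α j = d → P (pureTensor k n a))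
    {t : TPow k A n} (ht : t ∈ tensorDegree 𝒜 n d) : P t := by
  induction ht using Submodule.span_induction with
  | zero => exact zero
  | add t u _ _ h1 h2 => exact add t u h1 h2
  | smul c t _ h => exact smul c t h
  | mem t h =>
    obtain ⟨e, a, ha, hd, rfl⟩ := h
    have := pure (fun j => if h : j < n then e ⟨j, h⟩ else 0)
      (fun j => if h : j < n then a ⟨j, h⟩ else 1) ?_ ?_ ?_ ?_
    · convert this using 1
      simp [pureTensor]
    · intro j
      by_cases h : j < n
      · simpa [h] using ha ⟨j, h⟩
      · simpa [h] using SetLike.GradedOne.one_mem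
    · intro j hj
      simp [not_lt.2 hj]
    · intro j hj
      simp [not_lt.2 hj]
    · rw [Finset.sum_range, ← hd]
      simp

theorem scrF_mem {n : ℕ} {d : ℤ} {t : TPow k A (n + 1)} (ht : t ∈ tensorDegree 𝒜 (n + 1) d)
    {e : ℕ → ℤ} {x : ℕ → A} (hx : ∀ j, x j ∈ 𝒜 (e j)) :
    scrF 𝒜 n t (fun i => x i) ∈ 𝒜 (∑ j ∈ Finset.range n, e j + d) := by
  refine tensorDegree_induction
    (P := fun t => scrF 𝒜 n t (fun i => x i) ∈ 𝒜 (∑ j ∈ Finset.range n, e j + d))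
    ?_ ?_ ?_ ?_ ht
  · simp
  · intro t u h1 h2
    rw [map_add, add_apply]
    exact add_mem h1 h2
  · intro c t h
    rw [map_smul, smul_apply]
    exact Submodule.smul_mem _ _ h
  · intro α a ha _ _ hd
    rw [scrF_pureTensor ha hx, ← hd, add_comm]
    exact word_mem (fun j => Submodule.smul_mem _ _ (ha j)) hx

theorem place_eq_placeInj {m N : ℕ} {φ : ℕ → ℕ} {f : Fin m → Fin N} (hf : Function.Injective f)
    (h : ∀ i, (f i : ℕ) = φ i) : place (k := k) (A := A) φ = placeInj f hf := by
  have hex : ∃ f : Fin m → Fin N, Function.Injective f ∧ ∀ i, (f i : ℕ) = φ i := ⟨f, hf, h⟩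
  rw [place, dif_pos hex]
  congr 1
  exact funext fun i => Fin.ext (by rw [hex.choose_spec.2, h])

/-- Placing a pure tensor: the entries at the positions `φ i` are those of `a`, and all others
are `1`. -/
theorem place_pureTensor {m N : ℕ} (φ : ℕ → ℕ) (hφ : ∀ i < m, φ i < N)
    (hinj : ∀ i < m, ∀ j < m, φ i = φ j → i = j) {a c : ℕ → A}
    (h : ∀ i < m, c (φ i) = a i) (h1 : ∀ j < N, (∀ i < m, φ i ≠ j) → c j = 1) :
    place φ (pureTensor k m a) = pureTensor k N c := by
  have hf : Function.Injective (fun i : Fin m => (⟨φ i, hφ i i.2⟩ : Fin N)) := fun i j hij =>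
    Fin.ext (hinj i i.2 j j.2 (congrArg Fin.val hij))
  rw [place_eq_placeInj hf (fun _ => rfl)]
  rw [pureTensor, placeInj, PiTensorProduct.lift.tprod]
  change PiTensorProduct.tprod k _ = _
  rw [pureTensor]
  congr 1
  funext j
  by_cases hj : ∃ i : Fin m, (⟨φ i, hφ i i.2⟩ : Fin N) = j
  · obtain ⟨i, rfl⟩ := hj
    exact (hf.extend_apply _ _ i).trans (h i i.2).symm
  · rw [Function.extend_apply' _ _ _ hj]
    exact (h1 j j.2 (fun i hi hij => hj ⟨⟨i, hi⟩, Fin.ext hij⟩)).symm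

theorem place_self {m : ℕ} (φ : ℕ → ℕ) (hφ : ∀ i < m, φ i = i) (t : TPow k A m) :
    place (N := m) φ t = t := by
  rw [place_eq_placeInj Function.injective_id (fun i => (hφ i i.2).symm)]
  induction t using PiTensorProduct.induction_on with
  | smul_tprod c a =>
    rw [map_smul, placeInj, PiTensorProduct.lift.tprod]
    change c • PiTensorProduct.tprod k _ = _
    congr 2
    funext j
    exact Function.injective_id.extend_apply a _ j
  | add t u h1 h2 => rw [map_add, h1, h2]

end Sequences

/-! ### Placed pure tensors -/

section Placed

/-- The sequence `f`, delayed by `l` steps; the entries before `l` are `z`. -/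
def delay {X : Type*} (z : X) (l : ℕ) (f : ℕ → X) : ℕ → X :=
  fun j => if j < l then z else f (j - l)

/-- The sequence `f` with `w` entries `z` inserted at position `l`. -/
def insertGap {X : Type*} (z : X) (l w : ℕ) (f : ℕ → X) : ℕ → X :=
  fun j => if j < l then f j else if j < l + w then z else f (j - w)

section

variable {X : Type*} (z : X) (l w : ℕ) (f : ℕ → X)

theorem delay_lt {j : ℕ} (h : j < l) : delay z l f j = z := if_pos h

theorem delay_add (j : ℕ) : delay z l f (l + j) = f j := by
  rw [delay, if_neg (by omega), Nat.add_sub_cancel_left]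

theorem insertGap_lt {j : ℕ} (h : j < l) : insertGap z l w f j = f j := if_pos h

theorem insertGap_mid {j : ℕ} (h : l ≤ j) (h' : j < l + w) : insertGap z l w f j = z := by
  rw [insertGap, if_neg (by omega), if_pos h']

theorem insertGap_add (j : ℕ) : insertGap z l w f (l + w + j) = f (l + j) := by
  rw [insertGap, if_neg (by omega), if_neg (by omega)]
  congr 1
  omega

end

theorem sum_delay_le (l : ℕ) (β : ℕ → ℤ) {j : ℕ} (h : j ≤ l) :
    ∑ i ∈ Finset.range j, delay 0 l β i = 0 :=
  Finset.sum_eq_zero fun i hi => delay_lt _ _ _ (by have := Finset.mem_range.1 hi; omega)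

theorem sum_delay_add (l : ℕ) (β : ℕ → ℤ) (j : ℕ) :
    ∑ i ∈ Finset.range (l + j), delay 0 l β i = ∑ i ∈ Finset.range j, β i := by
  rw [Finset.sum_range_add, sum_delay_le l β le_rfl, zero_add]
  simp only [delay_add]

theorem sum_insertGap (l w : ℕ) (α : ℕ → ℤ) {j : ℕ} (h : j ≤ w) :
    ∑ i ∈ Finset.range (l + j), insertGap 0 l w α i = ∑ i ∈ Finset.range l, α i := by
  rw [Finset.sum_range_add, Finset.sum_congr rfl (fun i hi =>
    insertGap_lt 0 l w α (Finset.mem_range.1 hi)), add_eq_left]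
  exact Finset.sum_eq_zero fun i hi => insertGap_mid _ _ _ _ (by omega)
    (by have := Finset.mem_range.1 hi; omega)

theorem sum_range_of_le {β : ℕ → ℤ} {n N : ℕ} (hβ : ∀ j, n ≤ j → β j = 0) (h : n ≤ N) :
    ∑ i ∈ Finset.range N, β i = ∑ i ∈ Finset.range n, β i := by
  obtain ⟨j, rfl⟩ := Nat.exists_eq_add_of_le h
  rw [Finset.sum_range_add, add_eq_left]
  exact Finset.sum_eq_zero fun i _ => hβ _ (by omega)

variable {k : Type*} [Field k] {A : Type*} [Ring A] [Algebra k A]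
  {𝒜 : ℤ → Submodule k A} [GradedAlgebra 𝒜]

theorem delay_mem {β : ℕ → ℤ} {b : ℕ → A} (hb : ∀ j, b j ∈ 𝒜 (β j)) (l j : ℕ) :
    delay 1 l b j ∈ 𝒜 (delay 0 l β j) := by
  unfold delay
  split_ifs
  exacts [SetLike.GradedOne.one_mem, hb _]

theorem insertGap_mem {α : ℕ → ℤ} {a : ℕ → A} (ha : ∀ j, a j ∈ 𝒜 (α j)) (l w j : ℕ) :
    insertGap 1 l w a j ∈ 𝒜 (insertGap 0 l w α j) := by
  unfold insertGap
  split_ifs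
  exacts [ha _, SetLike.GradedOne.one_mem, ha _]

theorem koszul_mul_mem {α β : ℕ → ℤ} {a b : ℕ → A} (ha : ∀ j, a j ∈ 𝒜 (α j))
    (hb : ∀ j, b j ∈ 𝒜 (β j)) (j : ℕ) : koszul k α β a j * b j ∈ 𝒜 (α j + β j) :=
  SetLike.mul_mem_graded (Submodule.smul_mem _ _ (ha j)) (hb j)

theorem place_initial {p N : ℕ} (h : p ≤ N) {a : ℕ → A} (ha : ∀ j, p ≤ j → a j = 1) :
    place (N := N) (fun i => i) (pureTensor k p a) = pureTensor k N a :=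
  place_pureTensor _ (fun i hi => by omega) (fun i _ j _ h => h) (fun _ _ => rfl)
    (fun j _ h1 => ha j (by by_contra h2; exact h1 j (by omega) rfl))

theorem place_delay {q N l : ℕ} (h : l + q ≤ N) {b : ℕ → A} (hb : ∀ j, q ≤ j → b j = 1) :
    place (N := N) (fun i => l + i) (pureTensor k q b) = pureTensor k N (delay 1 l b) :=
  place_pureTensor _ (fun i hi => by omega) (fun i _ j _ h => by omega)
    (fun i _ => delay_add _ _ _ _) (fun j _ h1 => by
      by_cases h2 : j < l
      · exact delay_lt _ _ _ h2
      · obtain ⟨i, rfl⟩ := Nat.exists_eq_add_of_le (not_lt.1 h2)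
        rw [delay_add]
        exact hb i (by by_contra h3; exact h1 i (by omega) rfl))

theorem place_insertGap {p N l w : ℕ} (hp : p + w ≤ N) {a : ℕ → A} (ha : ∀ j, p ≤ j → a j = 1) :
    place (N := N) (fun i => if i < l then i else i + w) (pureTensor k p a) =
      pureTensor k N (insertGap 1 l w a) := by
  refine place_pureTensor _ (fun i hi => ?_) (fun i _ j _ h => ?_) (fun i _ => ?_)
    (fun j _ h1 => ?_)
  · split_ifs <;> omega
  · split_ifs at h <;> omega
  · by_cases h : i < l
    · rw [if_pos h, insertGap_lt _ _ _ _ h]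
    · rw [if_neg h]
      obtain ⟨i, rfl⟩ := Nat.exists_eq_add_of_le (not_lt.1 h)
      rw [show l + i + w = l + w + i by omega, insertGap_add]
  · by_cases h : j < l
    · rw [insertGap_lt _ _ _ _ h]
      exact ha j (by by_contra h3; exact h1 j (by omega) (if_pos h))
    · by_cases h' : j < l + w
      · exact insertGap_mid _ _ _ _ (not_lt.1 h) h'
      · obtain ⟨i, rfl⟩ := Nat.exists_eq_add_of_le (not_lt.1 h')
        rw [insertGap_add]
        refine ha _ ?_
        by_contra h3
        refine h1 (l + i) (by omega) ?_
        rw [if_neg (by omega)]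
        omega

end Placed

/-! ### Composition of operations in terms of tensors -/

section Composition

variable {k : Type*} [Field k] {A : Type*} [Ring A] [Algebra k A]
  {𝒜 : ℤ → Submodule k A}

theorem splice_mem {e : ℕ → ℤ} {x : ℕ → A} (hx : ∀ j, x j ∈ 𝒜 (e j)) {y : A} {ε : ℤ}
    (hy : y ∈ 𝒜 ε) (l q j : ℕ) : splice x l q y j ∈ 𝒜 (splice e l q ε j) := by
  unfold splice
  split_ifs
  exacts [hx _, hy, hx _]

variable [GradedAlgebra 𝒜]

/-- The two tensors overlap at position `p` only, so their product carries no sign. The sign on the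
right comes from moving `b` past `x 0, …, x (p - 1)`. -/
theorem scrF_concat_pure {α β e : ℕ → ℤ} {a b x : ℕ → A} {p q : ℕ} (ha : ∀ j, a j ∈ 𝒜 (α j))
    (hb : ∀ j, b j ∈ 𝒜 (β j)) (hx : ∀ j, x j ∈ 𝒜 (e j)) (ha1 : ∀ j, p + 1 ≤ j → a j = 1)
    (hα : ∀ j, p + 1 ≤ j → α j = 0) (hb1 : ∀ j, q + 1 ≤ j → b j = 1) :
    scrF 𝒜 (p + q) (gmul 𝒜 (place (fun i => i) (pureTensor k (p + 1) a))
        (place (fun i => p + i) (pureTensor k (q + 1) b))) (fun i => x i) =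
      sgn k ((∑ j ∈ Finset.range p, e j) * ∑ j ∈ Finset.range (q + 1), β j) •
        (scrF 𝒜 p (pureTensor k (p + 1) a) (fun i => x i) *
          scrF 𝒜 q (pureTensor k (q + 1) b) (fun i => x (p + i))) := by
  rw [place_initial (by omega) ha1, place_delay (by omega) hb1, gmul_pureTensor ha (delay_mem hb p),
    scrF_pureTensor (koszul_mul_mem ha (delay_mem hb p)) hx, scrF_pureTensor ha hx,
    scrF_pureTensor (x := fun j => x (p + j)) hb (fun j => hx (p + j)), ← mul_smul_comm,
    ← word_smul (a := fun j => sgn k ((∑ i ∈ Finset.range (p + j), e i) * β j) • b j)]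
  · apply word_mul_word
    · intro j hj
      simp only [koszul, sum_delay_le p β hj.le, delay_lt _ _ _ hj, zero_mul, sgn_zero, one_smul,
        mul_one, add_zero]
    · simp only [koszul, sum_delay_le p β le_rfl, zero_mul, sgn_zero, one_smul, add_zero, mul_add,
        sgn_add, smul_mul_smul_comm]
      rw [show delay 0 p β p = β 0 from delay_add _ _ _ 0,
        show delay 1 p b p = b 0 from delay_add _ _ _ 0]
    · intro j h1 _
      simp only [koszul, ha1 (p + j) (by omega), hα (p + j) (by omega), delay_add, mul_zero,
        sgn_zero, one_smul, one_mul, zero_add]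
  · intro j _
    simp only [koszul, smul_smul]
    rw [← sgn_add, Finset.sum_range_add, add_mul]

section

variable {X : Type*} (f : ℕ → X) (l q : ℕ) (y : X)

theorem splice_lt [Ring X] {j : ℕ} (h : j < l) : splice f l q y j = f j := if_pos h

theorem splice_self [Ring X] : splice f l q y l = y := by simp [splice]

theorem splice_add [Ring X] (j : ℕ) : splice f l q y (l + 1 + j) = f (l + q + 1 + j) := by
  rw [splice, if_neg (by omega), if_neg (by omega)]
  congr 1
  omega

end

theorem sum_splice_le (e : ℕ → ℤ) (l q : ℕ) (ε : ℤ) {j : ℕ} (h : j ≤ l) :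
    ∑ i ∈ Finset.range j, splice e l q ε i = ∑ i ∈ Finset.range j, e i :=
  Finset.sum_congr rfl fun i hi => splice_lt _ _ _ _ (by have := Finset.mem_range.1 hi; omega)

theorem sum_splice_add (e : ℕ → ℤ) (l q : ℕ) (ε d : ℤ)
    (hε : ε = d + ∑ i ∈ Finset.range (q + 1), e (l + i)) (j : ℕ) :
    ∑ i ∈ Finset.range (l + 1 + j), splice e l q ε i =
      d + ∑ i ∈ Finset.range (l + q + 1 + j), e i := by
  rw [Finset.sum_range_add, Finset.sum_range_add _ (l + q + 1), Finset.sum_range_succ,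
    sum_splice_le _ _ _ _ le_rfl, splice_self, add_assoc l q 1, Finset.sum_range_add _ l, hε]
  simp only [splice_add, ← add_assoc l q 1]
  ring

/-- All signs agree letter by letter: the entries of `a` behind the inserted block pass the total
degree of `b` on both sides, once because of the product of tensors and once because of the degree
of the inserted element. Only the sign of moving `b` past `x 0, …, x (l - 1)` remains. -/
theorem scrF_compLeft_pure {α β e : ℕ → ℤ} {a b x : ℕ → A} {l m q : ℕ}
    (ha : ∀ j, a j ∈ 𝒜 (α j)) (hb : ∀ j, b j ∈ 𝒜 (β j)) (hx : ∀ j, x j ∈ 𝒜 (e j))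
    (ha1 : ∀ j, l + 1 + m + 1 ≤ j → a j = 1)
    (hb1 : ∀ j, q + 1 ≤ j → b j = 1) (hβ : ∀ j, q + 1 ≤ j → β j = 0) :
    scrF 𝒜 (l + 1 + m + q)
        (gmul 𝒜 (place (fun i => if i < l + 1 then i else i + q) (pureTensor k (l + 1 + m + 1) a))
          (place (fun i => l + i) (pureTensor k (q + 1) b))) (fun i => x i) =
      sgn k ((∑ j ∈ Finset.range l, e j) * ∑ j ∈ Finset.range (q + 1), β j) •
        scrF 𝒜 (l + 1 + m) (pureTensor k (l + 1 + m + 1) a) (fun i => splice x l q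
          (scrF 𝒜 q (pureTensor k (q + 1) b) (fun i => x (l + i)) * x (l + q)) i) := by
  have hy : scrF 𝒜 q (pureTensor k (q + 1) b) (fun i => x (l + i)) * x (l + q) ∈
      𝒜 (∑ j ∈ Finset.range (q + 1), β j + ∑ j ∈ Finset.range (q + 1), e (l + j)) := by
    rw [scrF_pureTensor (x := fun j => x (l + j)) hb (fun j => hx (l + j)),
      Finset.sum_range_succ (fun j => e (l + j)), ← add_assoc]
    exact SetLike.mul_mem_graded
      (word_mem (x := fun j => x (l + j)) (fun j => Submodule.smul_mem _ _ (hb j))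
        (fun j => hx (l + j))) (hx _)
  have hB : word (fun j => sgn k ((∑ i ∈ Finset.range (l + j), e i) * β j) • b j)
      (fun j => x (l + j)) q =
      sgn k ((∑ j ∈ Finset.range l, e j) * ∑ j ∈ Finset.range (q + 1), β j) •
        word (koszul k β (fun j => e (l + j)) b) (fun j => x (l + j)) q := by
    refine word_smul _ _ _ (fun j _ => ?_)
    simp only [koszul, smul_smul]
    rw [← sgn_add, Finset.sum_range_add, add_mul]
  rw [place_insertGap (by omega) ha1, place_delay (by omega) hb1,
    gmul_pureTensor (insertGap_mem ha (l + 1) q) (delay_mem hb l),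
    scrF_pureTensor (koszul_mul_mem (insertGap_mem ha (l + 1) q) (delay_mem hb l)) hx,
    scrF_pureTensor ha (splice_mem hx hy l q), word_cut, splice_self,
    show l + 1 + m + q = l + q + 1 + m by omega, word_cut,
    scrF_pureTensor (x := fun j => x (l + j)) hb (fun j => hx (l + j)),
    word_mul_word (a := koszul k α e a)
      (b := fun j => sgn k ((∑ i ∈ Finset.range (l + j), e i) * β j) • b j), hB]
  · simp only [smul_mul_assoc, mul_smul_comm, mul_assoc]
    congr 2
    · exact word_congr (fun j hj => by simp only [koszul, sum_splice_le _ _ _ _ hj])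
        (fun j hj => (splice_lt _ _ _ _ hj).symm)
    · congr 2
      refine word_congr (fun j _ => ?_) (fun j _ => (splice_add _ _ _ _ _).symm)
      have h1 : delay 1 l b (l + q + 1 + j) = 1 := by
        rw [add_assoc, add_assoc, delay_add, hb1 _ (by omega)]
      have h2 : delay 0 l β (l + q + 1 + j) = 0 := by
        rw [add_assoc, add_assoc, delay_add, hβ _ (by omega)]
      have h3 : ∑ i ∈ Finset.range (l + q + 1 + j), delay 0 l β i =
          ∑ i ∈ Finset.range (q + 1), β i := by
        rw [add_assoc, add_assoc, sum_delay_add, sum_range_of_le hβ (by omega)]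
      simp only [koszul, h1, h2, h3, mul_one, add_zero, smul_smul, ← sgn_add,
        sum_splice_add _ _ _ _ _ rfl]
      rw [show l + q + 1 + j = l + 1 + q + j by omega, insertGap_add, insertGap_add, ← add_mul,
        add_comm (∑ i ∈ Finset.range (q + 1), β i)]
  · intro j hj
    simp only [koszul, sum_delay_le l β hj.le, delay_lt _ _ _ hj,
      insertGap_lt _ _ _ _ (hj.trans (Nat.lt_succ_self l)), zero_mul, sgn_zero, one_smul,
      mul_one, add_zero]
  · simp only [koszul, sum_delay_le l β le_rfl, insertGap_lt _ _ _ _ (Nat.lt_succ_self l),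
      zero_mul, sgn_zero, one_smul, add_zero, mul_add, sgn_add, smul_mul_smul_comm]
    rw [show delay 0 l β l = β 0 from delay_add _ _ _ 0,
      show delay 1 l b l = b 0 from delay_add _ _ _ 0]
  · intro j h1 h2
    simp only [koszul, delay_add, insertGap_mid _ (l + 1) q _ (show l + 1 ≤ l + j by omega)
      (by omega), mul_zero, sgn_zero, one_smul, one_mul, zero_add]

/-- Here the entries of `b` pass `a 0, …, a l` in the product of tensors, while the entries of `a`
behind the inserted block pass the total degree of `b` in the value on the right; the two signs
combine to that of interchanging `a` and `b`. -/
theorem scrF_compRight_pure {α β e : ℕ → ℤ} {a b x : ℕ → A} {l m q : ℕ}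
    (ha : ∀ j, a j ∈ 𝒜 (α j)) (hb : ∀ j, b j ∈ 𝒜 (β j)) (hx : ∀ j, x j ∈ 𝒜 (e j))
    (ha1 : ∀ j, l + 1 + m + 1 ≤ j → a j = 1)
    (hb1 : ∀ j, q + 1 ≤ j → b j = 1) (hβ : ∀ j, q + 1 ≤ j → β j = 0) :
    scrF 𝒜 (l + 1 + m + q)
        (gmul 𝒜 (place (fun i => l + 1 + i) (pureTensor k (q + 1) b))
          (place (fun i => if i < l + 1 then i else i + q) (pureTensor k (l + 1 + m + 1) a)))
          (fun i => x i) =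
      sgn k ((∑ j ∈ Finset.range (q + 1), β j) *
          (∑ j ∈ Finset.range (l + 1 + m + 1), α j + ∑ j ∈ Finset.range (l + 1), e j)) •
        scrF 𝒜 (l + 1 + m) (pureTensor k (l + 1 + m + 1) a) (fun i => splice x l q
          (x l * scrF 𝒜 q (pureTensor k (q + 1) b) (fun i => x (l + 1 + i))) i) := by
  have hy : x l * scrF 𝒜 q (pureTensor k (q + 1) b) (fun i => x (l + 1 + i)) ∈
      𝒜 (∑ j ∈ Finset.range (q + 1), β j + ∑ j ∈ Finset.range (q + 1), e (l + j)) := by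
    rw [scrF_pureTensor (x := fun j => x (l + 1 + j)) hb (fun j => hx (l + 1 + j)),
      Finset.sum_range_succ' (fun j => e (l + j))]
    convert SetLike.mul_mem_graded (hx l)
      (word_mem (x := fun j => x (l + 1 + j)) (n := q)
        (a := koszul k β (fun j => e (l + 1 + j)) b)
        (fun j => Submodule.smul_mem _ _ (hb j)) (fun j => hx (l + 1 + j))) using 2
    simp only [add_zero, add_assoc, add_comm 1]
    ring
  have hB : word (fun j => sgn k ((∑ i ∈ Finset.range (l + 1 + j), e i +
        ∑ i ∈ Finset.range (l + 1), α i) * β j) • b j) (fun j => x (l + 1 + j)) q =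
      sgn k ((∑ i ∈ Finset.range (l + 1), e i + ∑ i ∈ Finset.range (l + 1), α i) *
        ∑ j ∈ Finset.range (q + 1), β j) •
        word (koszul k β (fun j => e (l + 1 + j)) b) (fun j => x (l + 1 + j)) q := by
    refine word_smul _ _ _ (fun j _ => ?_)
    simp only [koszul, smul_smul]
    rw [← sgn_add, Finset.sum_range_add]
    congr 2
    ring
  have hA : ∀ x', word (fun j => koszul k α (splice e l q (∑ j ∈ Finset.range (q + 1), β j +
        ∑ j ∈ Finset.range (q + 1), e (l + j))) a (l + 1 + j)) x' m =
      sgn k ((∑ j ∈ Finset.range (q + 1), β j) * ∑ j ∈ Finset.range (m + 1), α (l + 1 + j)) •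
        word (fun j => sgn k ((∑ i ∈ Finset.range (l + 1 + q + j), e i) * α (l + 1 + j)) •
          a (l + 1 + j)) x' m := by
    intro x'
    refine word_smul _ (fun j => α (l + 1 + j)) _ (fun j _ => ?_)
    simp only [koszul, smul_smul, sum_splice_add _ _ _ _ _ rfl, ← sgn_add]
    rw [add_mul, add_right_comm l q 1]
  rw [place_insertGap (by omega) ha1, place_delay (by omega) hb1,
    gmul_pureTensor (delay_mem hb (l + 1)) (insertGap_mem ha (l + 1) q),
    scrF_pureTensor (koszul_mul_mem (delay_mem hb (l + 1)) (insertGap_mem ha (l + 1) q)) hx,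
    scrF_pureTensor ha (splice_mem hx hy l q), word_cut, splice_self,
    show l + 1 + m + q = l + 1 + (q + m) by omega, word_cut,
    scrF_pureTensor (x := fun j => x (l + 1 + j)) hb (fun j => hx (l + 1 + j)),
    word_mul_word
      (a := fun j => sgn k ((∑ i ∈ Finset.range (l + 1 + j), e i +
        ∑ i ∈ Finset.range (l + 1), α i) * β j) • b j)
      (b := fun j => sgn k ((∑ i ∈ Finset.range (l + 1 + q + j), e i) * α (l + 1 + j)) •
        a (l + 1 + j)), hB, hA]
  · simp only [smul_mul_assoc, mul_smul_comm, mul_assoc, smul_smul]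
    rw [← sgn_add, add_assoc (l + 1) m 1, Finset.sum_range_add α (l + 1) (m + 1)]
    congr 1
    · apply sgn_eq_of_eq_add (-(∑ j ∈ Finset.range (q + 1), β j) *
        ∑ j ∈ Finset.range (m + 1), α (l + 1 + j))
      ring
    congr 1
    · refine word_congr (fun j hj => ?_) (fun j hj => (splice_lt _ _ _ _ hj).symm)
      simp only [koszul, sum_splice_le _ _ _ _ hj, delay_lt _ (l + 1) _ (Nat.lt_succ_of_le hj),
        insertGap_lt _ (l + 1) _ _ (Nat.lt_succ_of_le hj), mul_zero, sgn_zero, one_smul, one_mul,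
        zero_add]
    · congr 2
      refine word_congr (fun _ _ => rfl) (fun j _ => ?_)
      rw [splice_add]
      congr 1
      omega
  · intro j hj
    simp only [koszul, delay_add, smul_smul, insertGap_mid _ (l + 1) q _
      (show l + 1 ≤ l + 1 + j by omega) (by omega), mul_one, sum_insertGap _ _ _ hj.le, add_zero]
    rw [← sgn_add, ← add_mul]
  · simp only [koszul, delay_add, sum_insertGap _ _ _ le_rfl]
    rw [show insertGap 0 (l + 1) q α (l + 1 + q) = α (l + 1) from insertGap_add _ _ _ _ 0,
      show insertGap 1 (l + 1) q a (l + 1 + q) = a (l + 1) from insertGap_add _ _ _ _ 0]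
    simp only [smul_mul_assoc, mul_smul_comm, smul_smul, ← sgn_add, add_zero]
    congr 2
    ring
  · intro j h1 _
    have h2 : l + 1 + (q + j) = l + 1 + q + j := by omega
    have h3 : delay 1 (l + 1) b (l + 1 + (q + j)) = 1 := by rw [delay_add, hb1 _ (by omega)]
    have h4 : delay 0 (l + 1) β (l + 1 + (q + j)) = 0 := by rw [delay_add, hβ _ (by omega)]
    simp only [koszul, h3, h4, mul_zero, sgn_zero, one_smul, one_mul, zero_add]
    rw [h2, insertGap_add, insertGap_add]

end Composition

section Composition

variable {k : Type*} [Field k] {A : Type*} [Ring A] [Algebra k A]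

/-- Filling the place left by `splice` is a linear operation. -/
def spliceMap {n : ℕ} (T : Op k A n) (x : ℕ → A) (l q : ℕ) (h : l < n) : A →ₗ[k] A :=
  T.toLinearMap (fun i => splice x l q 0 i) ⟨l, h⟩

theorem spliceMap_apply {n : ℕ} (T : Op k A n) (x : ℕ → A) (l q : ℕ) (h : l < n) (y : A) :
    spliceMap T x l q h y = T (fun i => splice x l q y i) := by
  rw [spliceMap, MultilinearMap.toLinearMap_apply]
  congr 1
  funext i
  rcases eq_or_ne i ⟨l, h⟩ with rfl | hi
  · rw [Function.update_self, splice_self]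
  · have hi' : (i : ℕ) ≠ l := fun h' => hi (Fin.ext h')
    rw [Function.update_of_ne hi, splice, splice]
    simp [hi']

variable {𝒜 : ℤ → Submodule k A} [GradedAlgebra 𝒜]

/-- The tensor of a product of two operations. -/
theorem scrF_concat {p q n : ℕ} (hn : p + q = n) {c d : ℤ} {t : TPow k A (p + 1)}
    {u : TPow k A (q + 1)} (ht : t ∈ tensorDegree 𝒜 (p + 1) c)
    (hu : u ∈ tensorDegree 𝒜 (q + 1) d) {e : ℕ → ℤ} {x : ℕ → A} (hx : ∀ j, x j ∈ 𝒜 (e j)) :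
    scrF 𝒜 n (gmul 𝒜 (place (N := n + 1) (fun i => i) t) (place (fun i => p + i) u))
        (fun i => x i) =
      sgn k (d * ∑ j ∈ Finset.range p, e j) •
        (scrF 𝒜 p t (fun i => x i) * scrF 𝒜 q u (fun i => x (p + i))) := by
  subst hn
  refine tensorDegree_induction (P := fun t => scrF 𝒜 (p + q) (gmul 𝒜 (place (N := p + q + 1)
    (fun i => i) t) (place (fun i => p + i) u)) (fun i => x i) =
      sgn k (d * ∑ j ∈ Finset.range p, e j) • (scrF 𝒜 p t (fun i => x i) *
        scrF 𝒜 q u (fun i => x (p + i)))) ?_ ?_ ?_ ?_ ht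
  · simp
  · intro t t' h h'
    simp only [map_add, LinearMap.add_apply, add_apply, h, h', add_mul, smul_add]
  · intro c t h
    simp only [map_smul, LinearMap.smul_apply, smul_apply, h, smul_mul_assoc]
    rw [smul_comm]
  intro α a ha ha1 hα _
  refine tensorDegree_induction (P := fun u => scrF 𝒜 (p + q) (gmul 𝒜 (place (N := p + q + 1)
    (fun i => i) (pureTensor k (p + 1) a)) (place (fun i => p + i) u)) (fun i => x i) =
      sgn k (d * ∑ j ∈ Finset.range p, e j) • (scrF 𝒜 p (pureTensor k (p + 1) a) (fun i => x i) *
        scrF 𝒜 q u (fun i => x (p + i)))) ?_ ?_ ?_ ?_ hu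
  · simp
  · intro t t' h h'
    simp only [map_add, add_apply, h, h', mul_add, smul_add]
  · intro c t h
    simp only [map_smul, smul_apply, h, mul_smul_comm]
    rw [smul_comm]
  intro β b hb hb1 _ hd
  rw [scrF_concat_pure ha hb hx ha1 hα hb1, hd, mul_comm d]

/-- The tensor of the composition which inserts `m₂ ∘ (R ⊗ id)` into an operation. -/
theorem scrF_compLeft {p q n l : ℕ} (hn : p + q = n) (hl : l < p) {c d : ℤ}
    {t : TPow k A (p + 1)} {u : TPow k A (q + 1)} (ht : t ∈ tensorDegree 𝒜 (p + 1) c)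
    (hu : u ∈ tensorDegree 𝒜 (q + 1) d) {e : ℕ → ℤ} {x : ℕ → A} (hx : ∀ j, x j ∈ 𝒜 (e j)) :
    scrF 𝒜 n (gmul 𝒜 (place (N := n + 1) (fun i => if i < l + 1 then i else i + q) t)
        (place (fun i => l + i) u)) (fun i => x i) =
      sgn k (d * ∑ j ∈ Finset.range l, e j) • scrF 𝒜 p t (fun i => splice x l q
        (scrF 𝒜 q u (fun i => x (l + i)) * x (l + q)) i) := by
  subst hn
  obtain ⟨m, rfl⟩ := Nat.exists_eq_add_of_le (Nat.succ_le_of_lt hl)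
  refine tensorDegree_induction (P := fun t => scrF 𝒜 (l + 1 + m + q) (gmul 𝒜
    (place (N := l + 1 + m + q + 1) (fun i => if i < l + 1 then i else i + q) t)
    (place (fun i => l + i) u)) (fun i => x i) =
      sgn k (d * ∑ j ∈ Finset.range l, e j) • scrF 𝒜 (l + 1 + m) t (fun i => splice x l q
        (scrF 𝒜 q u (fun i => x (l + i)) * x (l + q)) i)) ?_ ?_ ?_ ?_ ht
  · simp
  · intro t t' h h'
    simp only [map_add, LinearMap.add_apply, add_apply, h, h', smul_add]
  · intro c t h
    simp only [map_smul, LinearMap.smul_apply, smul_apply, h]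
    rw [smul_comm]
  intro α a ha ha1 _ _
  simp only [← spliceMap_apply _ x l q hl]
  refine tensorDegree_induction (P := fun u => scrF 𝒜 (l + 1 + m + q) (gmul 𝒜
    (place (N := l + 1 + m + q + 1) (fun i => if i < l + 1 then i else i + q)
      (pureTensor k (l + 1 + m + 1) a)) (place (fun i => l + i) u)) (fun i => x i) =
      sgn k (d * ∑ j ∈ Finset.range l, e j) •
        spliceMap (scrF 𝒜 (l + 1 + m) (pureTensor k (l + 1 + m + 1) a)) x l q hl
          (scrF 𝒜 q u (fun i => x (l + i)) * x (l + q))) ?_ ?_ ?_ ?_ hu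
  · simp
  · intro t t' h h'
    simp only [map_add, add_apply, h, h', add_mul, smul_add]
  · intro c t h
    simp only [map_smul, smul_apply, h, smul_mul_assoc]
    rw [smul_comm]
  intro β b hb hb1 hβ hd
  rw [scrF_compLeft_pure ha hb hx ha1 hb1 hβ, hd, mul_comm d, spliceMap_apply]

/-- The tensor of the composition which inserts `m₂ ∘ (id ⊗ S)` into an operation. -/
theorem scrF_compRight {p q n l : ℕ} (hn : p + q = n) (hl : l < p) {c d : ℤ}
    {t : TPow k A (p + 1)} {u : TPow k A (q + 1)} (ht : t ∈ tensorDegree 𝒜 (p + 1) c)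
    (hu : u ∈ tensorDegree 𝒜 (q + 1) d) {e : ℕ → ℤ} {x : ℕ → A} (hx : ∀ j, x j ∈ 𝒜 (e j)) :
    scrF 𝒜 n (gmul 𝒜 (place (N := n + 1) (fun i => l + 1 + i) u)
        (place (fun i => if i < l + 1 then i else i + q) t)) (fun i => x i) =
      sgn k (d * (c + ∑ j ∈ Finset.range (l + 1), e j)) • scrF 𝒜 p t (fun i => splice x l q
        (x l * scrF 𝒜 q u (fun i => x (l + 1 + i))) i) := by
  subst hn
  obtain ⟨m, rfl⟩ := Nat.exists_eq_add_of_le (Nat.succ_le_of_lt hl)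
  refine tensorDegree_induction (P := fun t => scrF 𝒜 (l + 1 + m + q) (gmul 𝒜
    (place (N := l + 1 + m + q + 1) (fun i => l + 1 + i) u)
    (place (fun i => if i < l + 1 then i else i + q) t)) (fun i => x i) =
      sgn k (d * (c + ∑ j ∈ Finset.range (l + 1), e j)) •
        scrF 𝒜 (l + 1 + m) t (fun i => splice x l q
          (x l * scrF 𝒜 q u (fun i => x (l + 1 + i))) i)) ?_ ?_ ?_ ?_ ht
  · simp
  · intro t t' h h'
    simp only [map_add, add_apply, h, h', smul_add]
  · intro c t h
    simp only [map_smul, smul_apply, h]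
    rw [smul_comm]
  intro α a ha ha1 _ hc
  simp only [← spliceMap_apply _ x l q hl]
  refine tensorDegree_induction (P := fun u => scrF 𝒜 (l + 1 + m + q) (gmul 𝒜
    (place (N := l + 1 + m + q + 1) (fun i => l + 1 + i) u)
    (place (fun i => if i < l + 1 then i else i + q) (pureTensor k (l + 1 + m + 1) a)))
      (fun i => x i) =
      sgn k (d * (c + ∑ j ∈ Finset.range (l + 1), e j)) •
        spliceMap (scrF 𝒜 (l + 1 + m) (pureTensor k (l + 1 + m + 1) a)) x l q hl
          (x l * scrF 𝒜 q u (fun i => x (l + 1 + i)))) ?_ ?_ ?_ ?_ hu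
  · simp
  · intro t t' h h'
    simp only [map_add, LinearMap.add_apply, add_apply, h, h', mul_add, smul_add]
  · intro c t h
    simp only [map_smul, LinearMap.smul_apply, smul_apply, h, mul_smul_comm]
    rw [smul_comm]
  intro β b hb hb1 hβ hd
  rw [scrF_compRight_pure ha hb hx ha1 hb1 hβ, hd, hc, spliceMap_apply]

end Composition

/-! ### The two systems of equations correspond -/

section Equations

variable {k : Type*} [Field k] {A : Type*} [Ring A] [Algebra k A]

theorem sum_Icc_one {M : Type*} [AddCommMonoid M] (n : ℕ) (f : ℕ → M) :
    ∑ l ∈ Finset.Icc 1 n, f l = ∑ i ∈ Finset.range n, f (i + 1) := by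
  induction n with
  | zero => simp
  | succ n ih => rw [Finset.sum_Icc_succ_top (by omega), ih, Finset.sum_range_succ]

theorem neg_sgn (z : ℤ) : -sgn k z = sgn k (1 + z) := by
  rw [sgn_add, sgn, sgn, zpow_one, neg_one_mul]

theorem mem_posPairs {n : ℕ} {p : ℕ × ℕ} :
    p ∈ posPairs n ↔ p.1 + p.2 = n ∧ 1 ≤ p.1 ∧ 1 ≤ p.2 := by
  simp [posPairs]

/-- The identification `A^{⊗ 1} = A`. -/
abbrev tensorOne : TPow k A 1 ≃ₗ[k] A := PiTensorProduct.subsingletonEquiv (0 : Fin 1)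

variable {𝒜 : ℤ → Submodule k A}

theorem tensorOne_mem {d : ℤ} {t : TPow k A 1} (ht : t ∈ tensorDegree 𝒜 1 d) :
    tensorOne t ∈ 𝒜 d := by
  induction ht using Submodule.span_induction with
  | zero => simp
  | add t u _ _ h1 h2 => rw [map_add]; exact add_mem h1 h2
  | smul c t _ h => rw [map_smul]; exact Submodule.smul_mem _ _ h
  | mem t h =>
    obtain ⟨e, a, ha, hd, rfl⟩ := h
    rw [tensorOne, PiTensorProduct.subsingletonEquiv_apply_tprod, ← hd]
    simpa using ha 0

theorem tensorOne_symm (a : A) :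
    (tensorOne (k := k)).symm a = PiTensorProduct.tprod k (fun _ : Fin 1 => a) := by
  rw [LinearEquiv.symm_apply_eq, tensorOne, PiTensorProduct.subsingletonEquiv_apply_tprod]

variable [GradedAlgebra 𝒜]

theorem scrF_zero {d : ℤ} {t : TPow k A 1} (ht : t ∈ tensorDegree 𝒜 1 d) (x : Fin 0 → A) :
    scrF 𝒜 0 t x = tensorOne t := by
  induction ht using Submodule.span_induction with
  | zero => simp
  | add t u _ _ h1 h2 => rw [map_add, map_add, add_apply, h1, h2]
  | smul c t _ h => rw [map_smul, map_smul, smul_apply, h]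
  | mem t h =>
    obtain ⟨e, a, ha, hd, rfl⟩ := h
    rw [scrF_tprod (ξ := fun _ => 0) ha (fun i => i.elim0), sandwich_tprod]
    simp [evalExp]

theorem ev_scrF (t : ∀ n : ℕ, TPow k A (n + 1)) {n : ℕ} (hn : 1 ≤ n) (x : ℕ → A) :
    ev (fun n => scrF 𝒜 (n + 1) (t (n + 1))) n x = scrF 𝒜 n (t n) (fun i => x i) := by
  obtain ⟨n, rfl⟩ := Nat.exists_eq_add_of_le' hn
  rfl

/-- The terms of a Yang-Baxter equation that contain `d = r₁ = s₁` correspond to the terms of the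
Rota-Baxter equation that contain `m₁ = -[d, -]`: these are the cases of the composition formulas in
which one of the tensors is `d`. -/
theorem scrF_differential_terms {d t : ∀ n : ℕ, TPow k A (n + 1)} {n : ℕ}
    (hd : d 0 ∈ tensorDegree 𝒜 1 (-1)) (ht : t n ∈ tensorDegree 𝒜 (n + 1) ((n : ℤ) - 1))
    {e : ℕ → ℤ} {x : ℕ → A} (hx : ∀ j, x j ∈ 𝒜 (e j)) :
    scrF 𝒜 n (∑ l ∈ Finset.range (n + 1),
      (sgn k n • gmul 𝒜 (t n) (place (fun a => l + a) (d 0)) +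
        gmul 𝒜 (place (fun a => l + a) (d 0)) (t n))) (fun i => x i) =
      -(-gcomm 𝒜 (tensorOne (d 0))) (scrF 𝒜 n (t n) (fun i => x i)) +
        sgn k (n - 1) • ∑ i ∈ Finset.range n, sgn k (∑ a ∈ Finset.range i, e a) •
          scrF 𝒜 n (t n) (fun j => splice x i 0 ((-gcomm 𝒜 (tensorOne (d 0))) (x i)) j) := by
  have hD := tensorOne_mem hd
  have htx := scrF_mem ht hx
  -- `t d` at the last position, and `d t` at the first one
  have h1 := scrF_concat (add_zero n) ht hd hx
  have h2 := scrF_concat (zero_add n) hd ht hx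
  have h3 := fun l (hl : l < n) => scrF_compLeft (add_zero n) hl ht hd hx
  have h4 := fun l (hl : l < n) => scrF_compRight (add_zero n) hl ht hd hx
  simp only [add_zero, ite_self, zero_add, place_self _ (fun _ _ => rfl), scrF_zero hd,
    Finset.range_zero, Finset.sum_empty, mul_zero, sgn_zero, one_smul] at h1 h2 h3 h4
  have h5 : ∀ l ∈ Finset.range n, sgn k (∑ a ∈ Finset.range l, e a) •
      scrF 𝒜 n (t n) (fun j => splice x l 0 ((-gcomm 𝒜 (tensorOne (d 0))) (x l)) j) =
      - (sgn k (∑ a ∈ Finset.range l, e a) •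
        scrF 𝒜 n (t n) (fun j => splice x l 0 (tensorOne (d 0) * x l) j)) +
      sgn k (∑ a ∈ Finset.range (l + 1), e a) •
        scrF 𝒜 n (t n) (fun j => splice x l 0 (x l * tensorOne (d 0)) j) := by
    intro l hl
    simp only [← spliceMap_apply _ x l 0 (Finset.mem_range.1 hl)]
    rw [LinearMap.neg_apply, gcomm_apply hD (hx l), neg_sub, map_sub, map_smul, smul_sub, smul_smul,
      ← sgn_add, Finset.sum_range_succ,
      sgn_eq_of_eq_add (-e l) (by ring : ∑ a ∈ Finset.range l, e a + -1 * e l =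
        ∑ a ∈ Finset.range l, e a + e l + 2 * -e l)]
    abel
  rw [Finset.sum_congr rfl h5, LinearMap.neg_apply, neg_neg, gcomm_apply hD htx,
    Finset.sum_add_distrib, Finset.sum_range_succ, Finset.sum_range_succ' (fun l =>
      gmul 𝒜 (place (fun a => l + a) (d 0)) (t n))]
  simp only [map_add, map_sum, map_smul, add_apply, sum_apply, smul_apply, zero_add]
  rw [h1, h2, Finset.sum_congr rfl (fun l hl => by rw [h3 l (Finset.mem_range.1 hl)]),
    Finset.sum_congr rfl (fun l hl => h4 l (Finset.mem_range.1 hl))]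
  simp only [Finset.sum_add_distrib, Finset.smul_sum, smul_add, smul_neg, smul_smul, ← sgn_add,
    Finset.sum_neg_distrib]
  have e1 : ∀ l, sgn k (n + -1 * ∑ a ∈ Finset.range l, e a) =
      - sgn k (n - 1 + ∑ a ∈ Finset.range l, e a) := by
    intro l
    rw [neg_sgn]
    exact sgn_eq_of_eq_add (- ∑ a ∈ Finset.range l, e a) (by ring)
  have e2 : ∀ l, sgn k (-1 * (n - 1 + ∑ a ∈ Finset.range (l + 1), e a)) =
      sgn k (n - 1 + ∑ a ∈ Finset.range (l + 1), e a) := fun l =>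
    sgn_eq_of_eq_add (-(n - 1 + ∑ a ∈ Finset.range (l + 1), e a)) (by ring)
  have e3 : sgn k (-1 * (∑ j ∈ Finset.range n, e j + (n - 1))) =
      sgn k (n - 1 + ∑ a ∈ Finset.range n, e a) :=
    sgn_eq_of_eq_add (-(n - 1 + ∑ a ∈ Finset.range n, e a)) (by ring)
  simp only [e1, e2, e3, neg_smul, Finset.sum_neg_distrib]
  abel

omit [GradedAlgebra 𝒜] in
/-- Operations are determined by their values on homogeneous elements. -/
theorem op_ext [DirectSum.Decomposition 𝒜] {n : ℕ} {T T' : Op k A n}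
    (h : ∀ (e : ℕ → ℤ) (x : ℕ → A), (∀ j, x j ∈ 𝒜 (e j)) →
      T (fun i => x i) = T' (fun i => x i)) : T = T' := by
  let b := (DirectSum.Decomposition.isInternal 𝒜).collectedBasis
    (fun i => Module.Basis.ofVectorSpace k (𝒜 i))
  refine Module.Basis.ext_multilinear (fun _ => b) (fun v => ?_)
  have := h (fun j => if h : j < n then (v ⟨j, h⟩).1 else 0)
    (fun j => if h : j < n then b (v ⟨j, h⟩) else 0) (fun j => ?_)
  · simpa using this
  · by_cases h : j < n
    · simpa [h] using DirectSum.IsInternal.collectedBasis_mem _ _ (v ⟨j, h⟩)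
    · simp [h]

/-- Under `𝓕`, which is injective on `A^{⊗ (n+1)}`, the Yang-Baxter equation becomes the
Rota-Baxter equation. -/
theorem YBEquation_iff_RBEquation {r s t : ∀ n : ℕ, TPow k A (n + 1)}
    (hr : ∀ n : ℕ, r n ∈ tensorDegree 𝒜 (n + 1) ((n : ℤ) - 1))
    (hs : ∀ n : ℕ, s n ∈ tensorDegree 𝒜 (n + 1) ((n : ℤ) - 1))
    (ht : ∀ n : ℕ, t n ∈ tensorDegree 𝒜 (n + 1) ((n : ℤ) - 1)) (hrs : r 0 = s 0)
    {n : ℕ} (hn : 1 ≤ n) (hinj : Function.Injective (scrF 𝒜 n)) :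
    YBEquation 𝒜 r s t n ↔ RBEquation 𝒜 (-gcomm 𝒜 (tensorOne (r 0)))
      (fun n => scrF 𝒜 (n + 1) (r (n + 1))) (fun n => scrF 𝒜 (n + 1) (s (n + 1)))
      (fun n => scrF 𝒜 (n + 1) (t (n + 1))) n := by
  have hom : ∀ T T' : Op k A n, T = T' ↔ ∀ (e : ℕ → ℤ) (x : ℕ → A), (∀ j, x j ∈ 𝒜 (e j)) →
      T (fun i => x i) = T' (fun i => x i) :=
    fun T T' => ⟨fun h _ _ _ => h ▸ rfl, fun h => op_ext (𝒜 := 𝒜) h⟩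
  rw [YBEquation, ← hinj.eq_iff, hom, RBEquation]
  refine forall₃_congr (fun e x hx => ?_)
  have hdr : r 0 ∈ tensorDegree 𝒜 1 (-1) := by simpa using hr 0
  rw [map_add (scrF 𝒜 n), add_apply, ← hrs, scrF_differential_terms hdr (ht n) hx]
  simp only [map_sum, sum_apply, map_add, map_smul, add_apply, smul_apply, ev_scrF t hn]
  have hprod : ∀ p ∈ posPairs n, sgn k (1 + p.1) • scrF 𝒜 n (gmul 𝒜
      (place (N := n + 1) (fun a => a) (t p.1)) (place (fun a => p.1 + a) (t p.2)))
        (fun i => x i) =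
      (sgn k (p.1 + 1) * sgn k ((p.2 - 1) * ∑ a ∈ Finset.range p.1, e a)) •
        (ev (fun n => scrF 𝒜 (n + 1) (t (n + 1))) p.1 x *
          ev (fun n => scrF 𝒜 (n + 1) (t (n + 1))) p.2 (fun a => x (p.1 + a))) := by
    intro p hp
    obtain ⟨h, h1, h2⟩ := mem_posPairs.1 hp
    rw [ev_scrF t h1, ev_scrF t h2, scrF_concat h (ht _) (ht _) hx, smul_smul, add_comm]
  have hleft : ∀ p ∈ posPairs n, ∑ l ∈ Finset.Icc 1 p.1,
      sgn k (l - 1 + (p.2 - 1) * (n - l - p.2 - 1)) • scrF 𝒜 n (gmul 𝒜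
        (place (N := n + 1) (fun a => if a < l then a else a + p.2) (t p.1))
          (place (fun a => l - 1 + a) (r p.2))) (fun i => x i) =
      ∑ i ∈ Finset.range p.1,
        (sgn k (i + (p.2 - 1) * (p.1 - i)) * sgn k ((p.2 - 1) * ∑ a ∈ Finset.range i, e a)) •
          ev (fun n => scrF 𝒜 (n + 1) (t (n + 1))) p.1 (splice x i p.2
            (ev (fun n => scrF 𝒜 (n + 1) (r (n + 1))) p.2 (fun a => x (i + a)) *
              x (i + p.2))) := by
    intro p hp
    obtain ⟨h, h1, h2⟩ := mem_posPairs.1 hp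
    rw [sum_Icc_one]
    refine Finset.sum_congr rfl (fun i hi => ?_)
    rw [ev_scrF t h1, ev_scrF r h2, Nat.add_sub_cancel,
      scrF_compLeft h (Finset.mem_range.1 hi) (ht _) (hr _) hx, smul_smul]
    congr 2
    apply sgn_eq_of_eq_add (1 - p.2)
    rw [← h]
    push_cast
    ring
  have hright : ∀ p ∈ posPairs n, ∑ l ∈ Finset.Icc 1 p.1,
      sgn k (l - 1 + (p.2 - 1) * (n - l - p.2 - 1)) • sgn k ((1 - p.2) * p.1) •
        scrF 𝒜 n (gmul 𝒜 (place (N := n + 1) (fun a => l + a) (s p.2))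
          (place (fun a => if a < l then a else a + p.2) (t p.1))) (fun i => x i) =
      ∑ i ∈ Finset.range p.1,
        (sgn k (i + (p.2 - 1) * (p.1 - i - 1)) *
          sgn k ((p.2 - 1) * ∑ a ∈ Finset.range (i + 1), e a)) •
          ev (fun n => scrF 𝒜 (n + 1) (t (n + 1))) p.1 (splice x i p.2
            (x i * ev (fun n => scrF 𝒜 (n + 1) (s (n + 1))) p.2 (fun a => x (i + 1 + a)))) := by
    intro p hp
    obtain ⟨h, h1, h2⟩ := mem_posPairs.1 hp
    rw [sum_Icc_one]
    refine Finset.sum_congr rfl (fun i hi => ?_)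
    rw [ev_scrF t h1, ev_scrF s h2, scrF_compRight h (Finset.mem_range.1 hi) (ht _) (hs _) hx,
      smul_smul, smul_smul, ← sgn_add, ← sgn_add, ← sgn_add]
    congr 1
    apply sgn_eq_of_eq_add (1 - p.2)
    rw [← h]
    push_cast
    ring
  simp only [smul_add, Finset.sum_add_distrib]
  rw [Finset.sum_congr rfl hprod, Finset.sum_congr rfl hleft, Finset.sum_congr rfl hright,
    ← sub_eq_zero, ← sub_eq_zero (a := _ + _)]
  refine Eq.congr ?_ rfl
  abel

end Equations

/-! ### Homogeneous matrix units -/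

section MatrixUnits

variable {k : Type*} [Field k] {V : Type*} [AddCommGroup V] [Module k V]

/-- A finite-dimensional graded space has a basis of homogeneous elements. -/
theorem exists_homogeneous_basis [FiniteDimensional k V] (𝒱 : ℤ → Submodule k V)
    [DirectSum.Decomposition 𝒱] : ∃ (n : ℕ) (b : Module.Basis (Fin n) k V) (deg : Fin n → ℤ),
      (∀ i, b i ∈ 𝒱 (deg i)) ∧ ∀ p, ∀ v ∈ 𝒱 p, ∀ i, deg i ≠ p → b.repr v i = 0 := by
  let b := (DirectSum.Decomposition.isInternal 𝒱).collectedBasis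
    (fun i => Module.Basis.ofVectorSpace k (𝒱 i))
  have hfin := Module.Finite.finite_basis b
  obtain ⟨n, ⟨σ⟩⟩ := Finite.exists_equiv_fin (Σ i, Module.Basis.ofVectorSpaceIndex k (𝒱 i))
  refine ⟨n, b.reindex σ, fun i => (σ.symm i).1, fun i => ?_, fun p v hv i hi => ?_⟩
  · rw [Module.Basis.reindex_apply]
    exact DirectSum.IsInternal.collectedBasis_mem _ _ _
  · rw [Module.Basis.repr_reindex_apply]
    exact DirectSum.IsInternal.collectedBasis_repr_of_mem_ne _ _ hi.symm hv

variable {ι : Type*} [Fintype ι] [DecidableEq ι] (b : Module.Basis ι k V)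

/-- The matrix unit of the basis `b` that maps `b j` to `b i`. -/
def matUnit (i j : ι) : Module.End k V := b.linearMap b (i, j)

theorem matUnit_apply (i j l : ι) : matUnit b i j (b l) = if j = l then b i else 0 :=
  Module.Basis.linearMap_apply_apply _ _ _ _

theorem matUnit_mul (i j i' j' : ι) :
    matUnit b i j * matUnit b i' j' = if j = i' then matUnit b i j' else 0 := by
  refine b.ext (fun l => ?_)
  rw [Module.End.mul_apply, matUnit_apply]
  split_ifs with h1 h2 h2 <;> simp [matUnit_apply, h1, h2]

theorem sum_repr_matUnit (f : Module.End k V) :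
    ∑ i, ∑ j, b.repr (f (b j)) i • matUnit b i j = f := by
  refine b.ext (fun l => ?_)
  simp only [LinearMap.sum_apply, LinearMap.smul_apply, matUnit_apply, smul_ite, smul_zero,
    Finset.sum_ite_eq', Finset.mem_univ, if_true]
  exact b.sum_repr _

variable {𝒱 : ℤ → Submodule k V} {deg : ι → ℤ}

theorem matUnit_mem (hb : ∀ i, b i ∈ 𝒱 (deg i))
    (hb0 : ∀ p, ∀ v ∈ 𝒱 p, ∀ i, deg i ≠ p → b.repr v i = 0) (i j : ι) :
    matUnit b i j ∈ endGrading 𝒱 (deg i - deg j) := by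
  intro p v hv
  rw [← b.sum_repr v, map_sum]
  simp only [map_smul, matUnit_apply, smul_ite, smul_zero, Finset.sum_ite_eq, Finset.mem_univ,
    if_true]
  by_cases h : deg j = p
  · subst h
    rw [add_sub_cancel]
    exact Submodule.smul_mem _ _ (hb i)
  · rw [hb0 p v hv j h, zero_smul]
    exact zero_mem _

omit [Fintype ι] [DecidableEq ι] in
theorem deg_eq_of_repr_ne_zero (hb : ∀ i, b i ∈ 𝒱 (deg i))
    (hb0 : ∀ p, ∀ v ∈ 𝒱 p, ∀ i, deg i ≠ p → b.repr v i = 0) {f : Module.End k V} {d : ℤ}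
    (hf : f ∈ endGrading 𝒱 d) {i j : ι} (h : b.repr (f (b j)) i ≠ 0) : deg i = deg j + d := by
  by_contra h'
  exact h (hb0 _ _ (hf _ _ (hb j)) i h')

end MatrixUnits

/-! ### The inverse of `𝓕` -/

section Inverse

variable {k : Type*} [Field k] {V : Type*} [AddCommGroup V] [Module k V]
  {ι : Type*} [Fintype ι] [DecidableEq ι] (b : Module.Basis ι k V)

theorem sandwich_matUnit {n : ℕ} (u v : Fin (n + 1) → ι) (v' u' : Fin n → ι) :
    sandwich (k := k) n (PiTensorProduct.tprod k (fun j => matUnit b (u j) (v j)))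
      (fun i => matUnit b (v' i) (u' i)) =
      if ∀ i, v i.castSucc = v' i ∧ u i.succ = u' i then matUnit b (u 0) (v (Fin.last n))
      else 0 := by
  induction n with
  | zero => simp [sandwich_tprod]
  | succ n ih =>
    have := ih (fun i => u i.castSucc) (fun i => v i.castSucc) (fun i => v' i.castSucc)
      (fun i => u' i.castSucc)
    rw [sandwich_tprod] at this
    rw [sandwich_tprod, List.ofFn_succ', List.concat_eq_append, List.prod_append,
      List.prod_singleton, ← mul_assoc, this]
    simp only [Fin.forall_fin_succ', Fin.succ_castSucc, Fin.castSucc_zero, Fin.succ_last]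
    by_cases h1 : ∀ i : Fin n, v i.castSucc.castSucc = v' i.castSucc ∧
        u i.succ.castSucc = u' i.castSucc
    · simp only [h1, implies_true, if_true, true_and, matUnit_mul]
      by_cases h2 : v (Fin.last n).castSucc = v' (Fin.last n)
      · by_cases h3 : u (Fin.last (n + 1)) = u' (Fin.last n)
        · simp [h2, h3, matUnit_mul]
        · simp [h2, h3, matUnit_mul, Ne.symm h3]
      · simp [h2]
    · rw [if_neg h1, if_neg (fun h => h1 h.1), zero_mul, zero_mul]

/-- The inverse of `𝓕`, in terms of a homogeneous basis `b` with degrees `deg`. Up to sign, `𝓕`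
maps tensors of matrix units bijectively to the operations that are nonzero on exactly one tuple
of matrix units, where they take a matrix unit as value. -/
def scrG (deg : ι → ℤ) (n : ℕ) :
    Op k (Module.End k V) n →ₗ[k] TPow k (Module.End k V) (n + 1) where
  toFun T := ∑ u : Fin (n + 1) → ι, ∑ v : Fin (n + 1) → ι,
    (sgn k (evalExp (fun j => deg (u j) - deg (v j))
        (fun i => deg (v i.castSucc) - deg (u i.succ))) *
      b.repr (T (fun i => matUnit b (v i.castSucc) (u i.succ)) (b (v (Fin.last n)))) (u 0)) •
      PiTensorProduct.tprod k (fun j => matUnit b (u j) (v j))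
  map_add' T T' := by
    simp only [add_apply, LinearMap.add_apply, map_add, Finsupp.add_apply, mul_add, add_smul,
      Finset.sum_add_distrib]
  map_smul' c T := by
    simp only [smul_apply, LinearMap.smul_apply, map_smul, Finsupp.smul_apply, smul_eq_mul,
      RingHom.id_apply, Finset.smul_sum, smul_smul]
    simp only [mul_left_comm]

omit [DecidableEq ι] in
/-- If `f u v` vanishes unless the last entries of `u` are `u'` and the first entries of `v` are
`v'`, then only the first entry of `u` and the last entry of `v` have to be summed over. -/
theorem sum_fin_fin {M : Type*} [AddCommMonoid M] {n : ℕ} (v' u' : Fin n → ι)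
    (f : (Fin (n + 1) → ι) → (Fin (n + 1) → ι) → M)
    (hf : ∀ u v, (¬ ∀ i : Fin n, v i.castSucc = v' i ∧ u i.succ = u' i) → f u v = 0) :
    ∑ u, ∑ v, f u v = ∑ i, ∑ j, f (Fin.cons i u') (Fin.snoc v' j) := by
  rw [← Equiv.sum_comp (Fin.consEquiv (fun _ => ι)), Fintype.sum_prod_type]
  refine Finset.sum_congr rfl (fun i _ => ?_)
  rw [Finset.sum_eq_single u']
  · rw [← Equiv.sum_comp (Fin.snocEquiv (fun _ => ι)), Fintype.sum_prod_type]
    refine Finset.sum_congr rfl (fun j _ => ?_)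
    rw [Finset.sum_eq_single v']
    · rfl
    · intro w _ hw
      obtain ⟨l, hl⟩ := Function.ne_iff.1 hw
      exact hf _ _ (fun h => hl (by simpa [Fin.snocEquiv] using (h l).1))
    · simp
  · intro w _ hw
    obtain ⟨l, hl⟩ := Function.ne_iff.1 hw
    exact Finset.sum_eq_zero fun v _ =>
      hf _ _ (fun h => hl (by simpa [Fin.consEquiv] using (h l).2))
  · simp

variable {b} {𝒱 : ℤ → Submodule k V} {deg : ι → ℤ} [FiniteDimensional k V]
  [DirectSum.Decomposition 𝒱]

theorem scrF_matUnit (hb : ∀ i, b i ∈ 𝒱 (deg i))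
    (hb0 : ∀ p, ∀ v ∈ 𝒱 p, ∀ i, deg i ≠ p → b.repr v i = 0) {n : ℕ} (u v : Fin (n + 1) → ι)
    (v' u' : Fin n → ι) :
    scrF (endGrading 𝒱) n (PiTensorProduct.tprod k (fun j => matUnit b (u j) (v j)))
      (fun i => matUnit b (v' i) (u' i)) =
      if ∀ i, v i.castSucc = v' i ∧ u i.succ = u' i then
        sgn k (evalExp (fun j => deg (u j) - deg (v j))
          (fun i => deg (v i.castSucc) - deg (u i.succ))) • matUnit b (u 0) (v (Fin.last n))
      else 0 := by
  rw [scrF_tprod (fun j => matUnit_mem b hb hb0 (u j) (v j))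
    (fun i => matUnit_mem b hb hb0 (v' i) (u' i)), sandwich_matUnit]
  split_ifs with h
  · simp only [h]
  · rw [smul_zero]

theorem scrG_scrF (hb : ∀ i, b i ∈ 𝒱 (deg i))
    (hb0 : ∀ p, ∀ v ∈ 𝒱 p, ∀ i, deg i ≠ p → b.repr v i = 0) {n : ℕ}
    (t : TPow k (Module.End k V) (n + 1)) :
    scrG b deg n (scrF (endGrading 𝒱) n t) = t := by
  suffices (scrG b deg n).comp (scrF (endGrading 𝒱) n) = LinearMap.id from
    LinearMap.congr_fun this t
  refine PiTensorProduct.ext (Module.Basis.ext_multilinear (fun _ => b.linearMap b) (fun w => ?_))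
  change scrG b deg n (scrF (endGrading 𝒱) n
    (PiTensorProduct.tprod k (fun j => matUnit b (w j).1 (w j).2))) =
      PiTensorProduct.tprod k (fun j => matUnit b (w j).1 (w j).2)
  have hw := scrF_matUnit hb hb0 (fun j => (w j).1) (fun j => (w j).2)
  simp only [scrG, LinearMap.coe_mk, AddHom.coe_mk, hw]
  rw [Finset.sum_eq_single (fun j => (w j).1), Finset.sum_eq_single (fun j => (w j).2)]
  · simp only [and_self, implies_true, if_true, LinearMap.smul_apply, matUnit_apply, map_smul,
      Finsupp.smul_apply, smul_eq_mul, Module.Basis.repr_self, Finsupp.single_eq_same, mul_one,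
      sgn_mul_self, one_smul]
  · intro v _ hv
    split_ifs with h
    · have hl : (w (Fin.last n)).2 ≠ v (Fin.last n) := fun hl =>
        hv (funext (Fin.lastCases hl.symm (fun i => (h i).1.symm)))
      simp [matUnit_apply, hl]
    · simp
  · simp
  · intro u _ hu
    refine Finset.sum_eq_zero (fun v _ => ?_)
    split_ifs with h
    · have hl : (w 0).1 ≠ u 0 := fun hl =>
        hu (funext (Fin.cases hl.symm (fun i => (h i).2.symm)))
      by_cases hv : (w (Fin.last n)).2 = v (Fin.last n)
      · simp [matUnit_apply, hv, hl]
      · simp [matUnit_apply, hv]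
    · simp
  · simp

theorem scrF_scrG (hb : ∀ i, b i ∈ 𝒱 (deg i))
    (hb0 : ∀ p, ∀ v ∈ 𝒱 p, ∀ i, deg i ≠ p → b.repr v i = 0) {n : ℕ}
    (T : Op k (Module.End k V) n) : scrF (endGrading 𝒱) n (scrG b deg n T) = T := by
  refine Module.Basis.ext_multilinear (fun _ => b.linearMap b) (fun w => ?_)
  change scrF (endGrading 𝒱) n (scrG b deg n T) (fun i => matUnit b (w i).1 (w i).2) =
    T (fun i => matUnit b (w i).1 (w i).2)
  have hw := fun u v => scrF_matUnit hb hb0 u v (fun i => (w i).1) (fun i => (w i).2)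
  simp only [scrG, LinearMap.coe_mk, AddHom.coe_mk, map_sum, map_smul, sum_apply, smul_apply, hw]
  rw [sum_fin_fin (fun i => (w i).1) (fun i => (w i).2)]
  · simp only [Fin.snoc_castSucc, Fin.cons_succ, and_self, implies_true, if_true, Fin.snoc_last,
      Fin.cons_zero, smul_smul, mul_right_comm _ _ (sgn k _), sgn_mul_self, one_mul]
    exact sum_repr_matUnit b _
  · intro u v h
    rw [if_neg h, smul_zero]

omit [FiniteDimensional k V] [DirectSum.Decomposition 𝒱] in
/-- Since `deg (u 0) - deg (v n) = ∑ (deg (v i) - deg (u (i + 1))) + d` for every nonzero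
coefficient, the degrees of all matrix units in the corresponding tensor add up to `d`. -/
theorem scrG_mem (hb : ∀ i, b i ∈ 𝒱 (deg i))
    (hb0 : ∀ p, ∀ v ∈ 𝒱 p, ∀ i, deg i ≠ p → b.repr v i = 0) {n : ℕ} {d : ℤ}
    {T : Op k (Module.End k V) n} (hT : IsOpOfDegree (endGrading 𝒱) T d) :
    scrG b deg n T ∈ tensorDegree (endGrading 𝒱) (n + 1) d := by
  refine Submodule.sum_mem _ (fun u _ => Submodule.sum_mem _ (fun v _ => ?_))
  by_cases h : b.repr (T (fun i => matUnit b (v i.castSucc) (u i.succ)) (b (v (Fin.last n))))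
      (u 0) = 0
  · rw [h, mul_zero, zero_smul]
    exact zero_mem _
  · refine Submodule.smul_mem _ _ (Submodule.subset_span ⟨fun j => deg (u j) - deg (v j), _,
      fun j => matUnit_mem b hb hb0 (u j) (v j), ?_, rfl⟩)
    have := deg_eq_of_repr_ne_zero b hb hb0
      (hT _ _ (fun i => matUnit_mem b hb hb0 (v i.castSucc) (u i.succ))) h
    rw [Finset.sum_sub_distrib] at this ⊢
    rw [Fin.sum_univ_succ (fun j => deg (u j)), Fin.sum_univ_castSucc (fun j => deg (v j))]
    linarith

variable (𝒱)

theorem scrF_injective (n : ℕ) : Function.Injective (scrF (endGrading 𝒱) n) := by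
  obtain ⟨N, b, deg, hb, hb0⟩ := exists_homogeneous_basis 𝒱
  exact Function.LeftInverse.injective (scrG_scrF hb hb0)

theorem exists_scrF_eq {n : ℕ} {d : ℤ} {T : Op k (Module.End k V) n}
    (hT : IsOpOfDegree (endGrading 𝒱) T d) :
    ∃ t ∈ tensorDegree (endGrading 𝒱) (n + 1) d, scrF (endGrading 𝒱) n t = T := by
  obtain ⟨N, b, deg, hb, hb0⟩ := exists_homogeneous_basis 𝒱
  exact ⟨_, scrG_mem hb hb0 hT, scrF_scrG hb hb0 T⟩

end Inverse

/-! ### Inner differentials -/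

section Differentials

variable {k : Type*} [Field k] {A : Type*} [Ring A] [Algebra k A]
  {𝒜 : ℤ → Submodule k A} [GradedAlgebra 𝒜]

theorem gcomm_mem {c d : ℤ} {x y : A} (hx : x ∈ 𝒜 c) (hy : y ∈ 𝒜 d) :
    gcomm 𝒜 x y ∈ 𝒜 (c + d) := by
  rw [gcomm_apply hx hy]
  refine sub_mem (SetLike.mul_mem_graded hx hy) (Submodule.smul_mem _ _ ?_)
  rw [add_comm]
  exact SetLike.mul_mem_graded hy hx

/-- An element of degree `-1` is odd, so its graded commutator squares to the commutator with its
square. -/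
theorem gcomm_gcomm {d : A} (hd : d ∈ 𝒜 (-1)) (x : A) :
    gcomm 𝒜 d (gcomm 𝒜 d x) = d * d * x - x * (d * d) := by
  induction x using DirectSum.Decomposition.inductionOn 𝒜 with
  | zero => simp
  | add x y hx hy => rw [map_add, map_add, hx, hy, mul_add, add_mul]; abel
  | @homogeneous e x =>
    rw [gcomm_apply hd (gcomm_mem hd x.2), gcomm_apply hd x.2]
    have h1 : sgn k (-1 * (-1 + e)) = -sgn k (-1 * e) := by
      rw [neg_sgn]
      congr 1
      ring
    rw [h1]
    simp only [mul_sub, sub_mul, mul_smul_comm, smul_mul_assoc, smul_sub, neg_mul, neg_smul,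
      smul_smul, sgn_mul_self, one_smul, mul_assoc]
    abel

theorem isDifferential_gcomm {d : A} (hd : d ∈ 𝒜 (-1)) (hdd : d * d = 0) :
    IsDifferential 𝒜 (-gcomm 𝒜 d) where
  degree e x hx := by
    rw [LinearMap.neg_apply, sub_eq_neg_add]
    exact neg_mem (gcomm_mem hd hx)
  sq_zero x := by
    rw [LinearMap.neg_apply, LinearMap.neg_apply, map_neg, neg_neg, gcomm_gcomm hd, hdd]
    simp
  leibniz e x y hx := by
    induction y using DirectSum.Decomposition.inductionOn 𝒜 with
    | zero => simp
    | add y z hy hz => rw [mul_add, map_add, hy, hz, map_add, mul_add, mul_add, smul_add]; abel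
    | @homogeneous f y =>
      simp only [LinearMap.neg_apply]
      rw [gcomm_apply hd (SetLike.mul_mem_graded hx y.2), gcomm_apply hd hx, gcomm_apply hd y.2,
        mul_add, sgn_add, sgn_eq_of_eq_add (a := -1 * e) (-e) (by ring : -1 * e = e + 2 * -e)]
      simp only [mul_sub, sub_mul, mul_smul_comm, smul_mul_assoc, smul_sub, smul_smul, mul_assoc,
        mul_neg, neg_mul, smul_neg]
      abel

theorem scrF_isOpOfDegree {n : ℕ} {d : ℤ} {t : TPow k A (n + 1)}
    (ht : t ∈ tensorDegree 𝒜 (n + 1) d) : IsOpOfDegree 𝒜 (scrF 𝒜 n t) d := by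
  intro e x hx
  have := scrF_mem ht (e := fun j => if h : j < n then e ⟨j, h⟩ else 0)
    (x := fun j => if h : j < n then x ⟨j, h⟩ else 0) (fun j => ?_)
  · rw [Finset.sum_range] at this
    simpa using this
  · by_cases h : j < n
    · simpa [h] using hx ⟨j, h⟩
    · simp [h]

omit [GradedAlgebra 𝒜] in
theorem tensorOne_symm_mem {d : ℤ} {a : A} (ha : a ∈ 𝒜 d) :
    (tensorOne (k := k)).symm a ∈ tensorDegree 𝒜 1 d := by
  rw [tensorOne_symm]
  exact Submodule.subset_span ⟨fun _ => d, fun _ => a, fun _ => ha, by simp, rfl⟩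

theorem gmul_tensorOne_symm {c d : ℤ} {x y : A} (hx : x ∈ 𝒜 c) (hy : y ∈ 𝒜 d) :
    gmul 𝒜 (tensorOne.symm x) (tensorOne.symm y) = tensorOne.symm (x * y) := by
  rw [tensorOne_symm, tensorOne_symm, tensorOne_symm,
    gmul_tprod (α := fun _ => c) (β := fun _ => d) (fun _ => hx) (fun _ => hy)]
  simp [mulExp]

end Differentials

section InnerDerivations

variable {k : Type*} [Field k] {V : Type*} [AddCommGroup V] [Module k V] [FiniteDimensional k V]
  {𝒱 : ℤ → Submodule k V} [DirectSum.Decomposition 𝒱]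

/-- An endomorphism of nonzero degree that commutes with all endomorphisms of degree `0` is `0`. -/
theorem eq_zero_of_commute {c : ℤ} (hc : c ≠ 0) {z : Module.End k V} (hz : z ∈ endGrading 𝒱 c)
    (h : ∀ x ∈ endGrading 𝒱 0, z * x = x * z) : z = 0 := by
  obtain ⟨n, b, deg, hb, hb0⟩ := exists_homogeneous_basis 𝒱
  refine b.ext (fun i => ?_)
  have h1 := h (matUnit b i i) (by simpa using matUnit_mem b hb hb0 i i)
  have h2 := LinearMap.congr_fun h1 (b i)
  rw [Module.End.mul_apply, Module.End.mul_apply, matUnit_apply, if_pos rfl] at h2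
  rw [h2, ← b.sum_repr (z (b i)), map_sum]
  simp only [map_smul, matUnit_apply, smul_ite, smul_zero, Finset.sum_ite_eq, Finset.mem_univ,
    if_true, LinearMap.zero_apply]
  rw [hb0 _ _ (hz _ _ (hb i)) i (by simpa using hc), zero_smul]

theorem gcomm_injective {d d' : Module.End k V} (hd : d ∈ endGrading 𝒱 (-1))
    (hd' : d' ∈ endGrading 𝒱 (-1)) (h : gcomm (endGrading 𝒱) d = gcomm (endGrading 𝒱) d') :
    d = d' := by
  rw [← sub_eq_zero]
  have hz := sub_mem hd hd'
  refine eq_zero_of_commute (by norm_num) hz (fun x hx => ?_)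
  have h1 : gcomm (endGrading 𝒱) (d - d') x = 0 := by
    rw [map_sub, h, sub_self, LinearMap.zero_apply]
  rw [gcomm_apply hz hx, mul_zero, sgn_zero, one_smul] at h1
  exact sub_eq_zero.1 h1

/-- Every derivation `m` of degree `-1` of `End(V)` is inner: `m = [c, -]` for
`c = ∑ i, m (e i o) e o i`, where `e i j` are homogeneous matrix units and `o` is any fixed index. -/
theorem exists_eq_gcomm {m : Module.End k V →ₗ[k] Module.End k V}
    (hm : IsDifferential (endGrading 𝒱) m) :
    ∃ d ∈ endGrading 𝒱 (-1), m = -gcomm (endGrading 𝒱) d := by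
  obtain ⟨n, b, deg, hb, hb0⟩ := exists_homogeneous_basis 𝒱
  -- without basis vectors there is no index `o`, but then `V = 0`
  rcases n with _ | n
  · have : Subsingleton V := b.repr.toEquiv.subsingleton
    exact ⟨0, zero_mem _, LinearMap.ext fun x => Subsingleton.elim _ _⟩
  have hE := matUnit_mem b hb hb0
  have hc : ∑ i, m (matUnit b i 0) * matUnit b 0 i ∈ endGrading 𝒱 (-1) := by
    refine sum_mem (fun i _ => ?_)
    convert SetLike.mul_mem_graded (hm.degree _ _ (hE i 0)) (hE 0 i) using 1
    congr 1
    ring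
  refine ⟨-∑ i, m (matUnit b i 0) * matUnit b 0 i, neg_mem hc, LinearMap.ext fun x => ?_⟩
  rw [map_neg, neg_neg]
  induction x using DirectSum.Decomposition.inductionOn (endGrading 𝒱) with
  | zero => simp
  | add x y hx hy => rw [map_add, map_add, hx, hy]
  | @homogeneous e x =>
    rw [gcomm_apply hc x.2, sgn_eq_of_eq_add (a := -1 * e) (-e) (by ring : -1 * e = e + 2 * -e)]
    have row : ∀ i, matUnit b 0 i * (x : Module.End k V) =
        ∑ j, b.repr ((x : Module.End k V) (b j)) i • matUnit b 0 j := by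
      intro i
      conv_lhs => rw [← sum_repr_matUnit b (x : Module.End k V)]
      simp only [Finset.mul_sum, mul_smul_comm, matUnit_mul, smul_ite, smul_zero]
      rw [Finset.sum_eq_single i]
      · simp
      · intro l _ hl
        simp [Ne.symm hl]
      · simp
    have col : ∀ j, (x : Module.End k V) * matUnit b j 0 =
        ∑ i, b.repr ((x : Module.End k V) (b j)) i • matUnit b i 0 := by
      intro j
      conv_lhs => rw [← sum_repr_matUnit b (x : Module.End k V)]
      simp only [Finset.sum_mul, smul_mul_assoc, matUnit_mul, smul_ite, smul_zero,
        Finset.sum_ite_eq', Finset.mem_univ, if_true]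
    have one : ∑ j, matUnit b j 0 * matUnit b 0 j = 1 := by
      refine b.ext (fun l => ?_)
      simp [matUnit_mul, LinearMap.sum_apply, matUnit_apply]
    -- expand `m (x e j o)` by the Leibniz rule; the matrix entries of `x` turn
    -- `∑ j, m (x e j o) e o j` into `c x`
    calc m x = m x * ∑ j, matUnit b j 0 * matUnit b 0 j := by rw [one, mul_one]
      _ = ∑ j, (m (x * matUnit b j 0) - sgn k e • ((x : Module.End k V) * m (matUnit b j 0))) *
          matUnit b 0 j := by
        rw [Finset.mul_sum]
        refine Finset.sum_congr rfl (fun j _ => ?_)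
        rw [hm.leibniz e _ _ x.2, add_sub_cancel_right, mul_assoc]
      _ = _ := by
        simp only [sub_mul, Finset.sum_sub_distrib, col, map_sum, map_smul, Finset.sum_mul,
          smul_mul_assoc, mul_assoc, row, Finset.mul_sum, mul_smul_comm, Finset.smul_sum]
        rw [Finset.sum_comm]

theorem isDifferential_iff {m : Module.End k V →ₗ[k] Module.End k V} :
    IsDifferential (endGrading 𝒱) m ↔
      ∃ d ∈ endGrading 𝒱 (-1), d * d = 0 ∧ m = -gcomm (endGrading 𝒱) d := by
  refine ⟨fun hm => ?_, ?_⟩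
  · obtain ⟨d, hd, rfl⟩ := exists_eq_gcomm hm
    refine ⟨d, hd, eq_zero_of_commute (by norm_num) (SetLike.mul_mem_graded hd hd)
      (fun x _ => ?_), rfl⟩
    have := hm.sq_zero x
    rw [LinearMap.neg_apply, LinearMap.neg_apply, map_neg, neg_neg, gcomm_gcomm hd] at this
    exact sub_eq_zero.1 this
  · rintro ⟨d, hd, hdd, rfl⟩
    exact isDifferential_gcomm hd hdd

end InnerDerivations

/-! ### The bijection -/

section Bijection

/-- The family of tensors with first member `t₀` and the further members `t`. -/
def consFamily {k : Type*} [Field k] {A : Type*} [Ring A] [Algebra k A] (t₀ : TPow k A 1)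
    (t : ∀ n : ℕ, TPow k A (n + 2)) : ∀ n : ℕ, TPow k A (n + 1)
  | 0 => t₀
  | n + 1 => t n

variable {k : Type*} [Field k] {V : Type*} [AddCommGroup V] [Module k V] [FiniteDimensional k V]
  (𝒱 : ℤ → Submodule k V) [DirectSum.Decomposition 𝒱]

/-- For families of tensors of the right degrees with `r₁ = s₁`, the map `chi` matches the
conditions on `(r, s)` with those on its image. -/
theorem isInfYBPair_iff {r s : ∀ n : ℕ, TPow k (Module.End k V) (n + 1)}
    (hr : ∀ n : ℕ, r n ∈ tensorDegree (endGrading 𝒱) (n + 1) ((n : ℤ) - 1))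
    (hs : ∀ n : ℕ, s n ∈ tensorDegree (endGrading 𝒱) (n + 1) ((n : ℤ) - 1)) (hrs : r 0 = s 0) :
    IsInfYBPair (endGrading 𝒱) r s ↔
      IsDifferential (endGrading 𝒱) (chi (endGrading 𝒱) (r, s)).1 ∧
      IsHomotopyCoupledRB (endGrading 𝒱) (chi (endGrading 𝒱) (r, s)).1
        (chi (endGrading 𝒱) (r, s)).2.1 (chi (endGrading 𝒱) (r, s)).2.2 := by
  have hd : tensorOne (r 0) ∈ endGrading 𝒱 (-1) := tensorOne_mem (by simpa using hr 0)
  have hsq : gmul (endGrading 𝒱) (r 0) (r 0) = 0 ↔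
      IsDifferential (endGrading 𝒱) (chi (endGrading 𝒱) (r, s)).1 := by
    rw [← tensorOne.symm_apply_apply (r 0), gmul_tensorOne_symm hd hd,
      LinearEquiv.map_eq_zero_iff, isDifferential_iff]
    refine ⟨fun h => ⟨_, hd, h, rfl⟩, ?_⟩
    rintro ⟨d, hd', hdd, h⟩
    rwa [gcomm_injective hd hd' (neg_injective h)]
  have hdeg : ∀ t : ∀ n : ℕ, TPow k (Module.End k V) (n + 1),
      (∀ n : ℕ, t n ∈ tensorDegree (endGrading 𝒱) (n + 1) ((n : ℤ) - 1)) → ∀ n : ℕ,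
        IsOpOfDegree (endGrading 𝒱) (scrF (endGrading 𝒱) (n + 1) (t (n + 1))) n := by
    intro t ht n
    have := scrF_isOpOfDegree (ht (n + 1))
    rwa [Nat.cast_succ, add_sub_cancel_right] at this
  constructor
  · intro h
    exact ⟨hsq.1 h.sq_zero, hdeg r hr, hdeg s hs,
      fun n hn => (YBEquation_iff_RBEquation hr hs hr hrs hn (scrF_injective 𝒱 n)).1 (h.eq_r n hn),
      fun n hn => (YBEquation_iff_RBEquation hr hs hs hrs hn (scrF_injective 𝒱 n)).1 (h.eq_s n hn)⟩
  · rintro ⟨hm, h⟩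
    exact ⟨hr, hs, hrs, hsq.2 hm,
      fun n hn => (YBEquation_iff_RBEquation hr hs hr hrs hn (scrF_injective 𝒱 n)).2 (h.eq_R n hn),
      fun n hn => (YBEquation_iff_RBEquation hr hs hs hrs hn (scrF_injective 𝒱 n)).2 (h.eq_S n hn)⟩

end Bijection

end InfYB

end

theorem mainTheorem2 {k : Type*} [Field k] [CharZero k] {V : Type*} [AddCommGroup V] [Module k V]
    [FiniteDimensional k V] (𝒱 : ℤ → Submodule k V) [DirectSum.Decomposition 𝒱] :
    Set.BijOn (InfYB.chi (InfYB.endGrading 𝒱))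
      {rs | InfYB.IsInfYBPair (InfYB.endGrading 𝒱) rs.1 rs.2}
      {mRS | InfYB.IsDifferential (InfYB.endGrading 𝒱) mRS.1 ∧
        InfYB.IsHomotopyCoupledRB (InfYB.endGrading 𝒱) mRS.1 mRS.2.1 mRS.2.2} := by
  refine ⟨?_, ?_, ?_⟩
  · rintro ⟨r, s⟩ h
    exact (InfYB.isInfYBPair_iff 𝒱 h.r_degree h.s_degree h.one_eq).1 h
  · rintro ⟨r, s⟩ h ⟨r', s'⟩ h' heq
    simp only [InfYB.chi, Prod.mk.injEq] at heq
    obtain ⟨hm, hR, hS⟩ := heq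
    have h0 : r 0 = r' 0 := InfYB.tensorOne.injective (InfYB.gcomm_injective
      (InfYB.tensorOne_mem (by simpa using h.r_degree 0))
      (InfYB.tensorOne_mem (by simpa using h'.r_degree 0)) (neg_injective hm))
    have h1 : r = r' := by
      funext n
      rcases n with _ | n
      · exact h0
      · exact InfYB.scrF_injective 𝒱 (n + 1) (congrFun hR n)
    have h2 : s = s' := by
      funext n
      rcases n with _ | n
      · exact (h.one_eq.symm.trans h0).trans h'.one_eq
      · exact InfYB.scrF_injective 𝒱 (n + 1) (congrFun hS n)
    rw [h1, h2]
  · rintro ⟨m, R, S⟩ ⟨hm, hRS⟩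
    obtain ⟨d, hd, -, rfl⟩ := InfYB.isDifferential_iff.1 hm
    choose r hr hrR using fun n => InfYB.exists_scrF_eq 𝒱 (hRS.R_degree n)
    choose s hs hsS using fun n => InfYB.exists_scrF_eq 𝒱 (hRS.S_degree n)
    have hdeg : ∀ t : ∀ n : ℕ, InfYB.TPow k (Module.End k V) (n + 2),
        (∀ n : ℕ, t n ∈ InfYB.tensorDegree (InfYB.endGrading 𝒱) (n + 2) n) → ∀ n : ℕ,
          InfYB.consFamily (InfYB.tensorOne.symm d) t n ∈
            InfYB.tensorDegree (InfYB.endGrading 𝒱) (n + 1) ((n : ℤ) - 1) := by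
      intro t ht n
      rcases n with _ | n
      · simpa [InfYB.consFamily] using InfYB.tensorOne_symm_mem hd
      · simpa [InfYB.consFamily] using ht n
    have hchi : InfYB.chi (InfYB.endGrading 𝒱) (InfYB.consFamily (InfYB.tensorOne.symm d) r,
        InfYB.consFamily (InfYB.tensorOne.symm d) s) =
          (-InfYB.gcomm (InfYB.endGrading 𝒱) d, R, S) := by
      simp only [InfYB.chi, InfYB.consFamily, hrR, hsS, LinearEquiv.apply_symm_apply]
    refine ⟨_, (InfYB.isInfYBPair_iff 𝒱 (hdeg r hr) (hdeg s hs) rfl).2 ?_, hchi⟩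
    rw [hchi]
    exact ⟨hm, hRS⟩
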